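/- **Setting.** Let $(M,g)$ be a globally hyperbolic spacetime of dimension $n\ge 2$: a smooth (Hausdorff, second countable) time-oriented Lorentzian manifold of signature $(+,-,\dots,-)$ possessing a smooth spacelike Cauchy hypersurface. Let $E\to M$ be a smooth finite-rank complex vector bundle with a smooth nondegenerate (not necessarily positive definite) hermitian form $\langle\cdot,\cdot\rangle$ on its fibres, conjugate-linear in the first slot, and let $\Box$ be a normally hyperbolic operator on $C^\infty(M;E)$, i.e. a second-order linear differential operator with principal symbol $-g^{-1}$. Assume that $\Box$ is formally self-adjoint with respect to $\langle f,h\rangle=\int_M\langle f(x),h(x)\rangle\,d\mathrm{vol}_g$. Let $f\mapsto\overline f$ be a complex conjugation on $E$ (a smooth fibrewise conjugate-linear involution with $\langle\overline v,\overline w\rangle=\overline{\langle v,w\rangle}$) that commutes with $\Box$. Write $\langle\!\langle u,f\rangle\!\rangle$ for the integrated duality pairing of sections of $E^*$ and $E$, $\Box^\sharp$ for the formal dual of $\Box$ acting on sections of $E^*$, $f^\star$ for the section of $E^*$ with $\langle\!\langle f^\star,h\rangle\!\rangle=\langle f,h\rangle$, and $f^T=(\overline f)^\star$. Let $G=G_{\rm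 adv}-G_{\rm ret}$, where $G_{\rm ret},G_{\rm adv}:C_0^\infty(M;E)\to C^\infty(M;E)$ are the unique retarded and advanced fundamental solutions of $\Box$ (two-sided inverses with $\operatorname{supp}G_{\rm ret/adv}f\subset J^{\pm}(\operatorname{supp}f)$), and $G_{\rm PJ}(f\otimes h)=\langle\overline f,Gh\rangle$. **Algebras and states.** $\mathcal C(\Box)$ is the unital $*$-algebra generated by symbols $\Phi(u)$, $\Phi^\star(f)$ ($u\in C_0^\infty(M;E^*)$, $f\in C_0^\infty(M;E)$), complex-linear in $u$ and $f$, with relations $\Phi^\star(f)=\Phi(f^\star)^*$, $\Phi^\star(\Box f)=0=\Phi(\Box^\sharp u)$, $[\Phi(u),\Phi^\star(f)]=i\langle\!\langle u,Gf\rangle\!\rangle 1$, $[\Phi(u),\Phi(v)]=0$. $\mathcal A(\Box)$ is the unital $*$-algebra generated by symbols $\Upsilon(f)$, complex-linear in $f\in C_0^\infty(M;E)$, with relations $\Upsilon(f)=\Upsilon(\overline f)^*$, $\Upsilon(\Box f)=0$, $[\Upsilon(f),\Upsilon(h)]=iG_{\rm PJ}(f\otimes h)1$. A state is a linear functional $\omega$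 with $\omega(1)=1$ and $\omega(A^*A)\ge0$ for all $A$. A state $\omega$ on $\mathcal C(\Box)$ is gauge-invariant quasifree with two-point distributions $W_{\Phi\Phi^\star}\in\mathcal D'(M\times M;E\boxtimes E^*)$, $W_{\Phi^\star\Phi}\in\mathcal D'(M\times M;E^*\boxtimes E)$ if $W_{\Phi\Phi^\star}(u\otimes f)=\omega(\Phi(u)\Phi^\star(f))$, $W_{\Phi^\star\Phi}(f\otimes u)=\omega(\Phi^\star(f)\Phi(u))$ and, as formal series in $u$ and $f$, $$\omega\big(e^{i(\Phi(u)+\Phi^\star(f))}\big)=e^{-\frac12\left(W_{\Phi\Phi^\star}(u\otimes f)+W_{\Phi^\star\Phi}(f\otimes u)\right)}.$$ A state $\omega'$ on $\mathcal A(\Box)$ is quasifree with two-point distribution $W\in\mathcal D'(M\times M;E^*\boxtimes E^*)$ if $W(f\otimes h)=\omega'(\Upsilon(f)\Upsilon(h))$ and $\omega'(e^{i\Upsilon(f)})=e^{-W(f\otimes f)/2}$ as formal series in $f$. **Hadamard condition.** Wavefront sets are taken with respect to the Fourier transform convention $\hat f(k)=\int e^{-ik\cdot x}f(x)\,dx$,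 and $\mathrm{WF}'(W)=\{(x,\xi;x',\xi'):(x,\xi;x',-\xi')\in\mathrm{WF}(W)\}$. Let $C_-$ be the set of all $(x,\xi;x',\xi')$ such that $\xi$ is a nonzero null covector, negative on future-directed timelike vectors, and $(x,\xi)=\Phi_t(x',\xi')$ for some $t\in\mathbb R$, where $\Phi_t$ is the geodesic flow on $T^*M$. The state $\omega$ on $\mathcal C(\Box)$ is Hadamard if $\mathrm{WF}'(W_{\Phi\Phi^\star})=\mathrm{WF}'(W_{\Phi^\star\Phi})=C_-$; the state $\omega'$ on $\mathcal A(\Box)$ is Hadamard if $\mathrm{WF}'(W)\subset C_-$. **Statement.** Let $\omega$ be a gauge-invariant quasifree Hadamard state on $\mathcal C(\Box)$ with two-point distributions $W_{\Phi\Phi^\star}$ and $W_{\Phi^\star\Phi}$. Then $$W(f\otimes h)=\tfrac12\Big(W_{\Phi^\star\Phi}(f\otimes h^T+h\otimes f^T)+i\,G_{\rm PJ}(f\otimes h)\Big)\qquad(f,h\in C_0^\infty(M;E))$$ defines a distribution $W\in\mathcal D'(M\times M;E^*\boxtimes E^*)$ with $\mathrm{WF}'(W)\subset C_-$, and there is exactly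 one quasifree state on $\mathcal A(\Box)$ with two-point distribution $W$; in particular this state is Hadamard. -/

import Mathlib

open Bundle Manifold MeasureTheory Set Filter Topology
open scoped ContDiff ComplexOrder

noncomputable section

namespace QFT

/-! ## Presented unital star-algebras over the complex numbers -/

section StarAlgebra

/-- The opposite of a complex algebra, with scalars acting through complex conjugation. -/
def ConjOp (A : Type*) := Aᵐᵒᵖ

instance (A : Type*) [Ring A] : Ring (ConjOp A) := inferInstanceAs (Ring Aᵐᵒᵖ)

instance (A : Type*) [Ring A] [Algebra ℂ A] : Algebra ℂ (ConjOp A) :=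
  RingHom.toAlgebra' (S := ConjOp A) ((algebraMap ℂ Aᵐᵒᵖ).comp (starRingEnd ℂ))
    (fun c x => Algebra.commutes (A := Aᵐᵒᵖ) (starRingEnd ℂ c) x)

/-- The free complex unital star-algebra on a set `Y`: noncommutative polynomials in the symbols
`y` (encoded as `Sum.inl y`) and their formal adjoints (encoded as `Sum.inr y`). -/
def FreeStarAlg (Y : Type*) := FreeAlgebra ℂ (Y ⊕ Y)

instance (Y : Type*) : Ring (FreeStarAlg Y) := inferInstanceAs (Ring (FreeAlgebra ℂ (Y ⊕ Y)))

instance (Y : Type*) : Algebra ℂ (FreeStarAlg Y) :=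
  inferInstanceAs (Algebra ℂ (FreeAlgebra ℂ (Y ⊕ Y)))

namespace FreeStarAlg

variable {Y : Type*}

/-- Generators and formal adjoints of generators. -/
def sym (z : Y ⊕ Y) : FreeStarAlg Y := FreeAlgebra.ι ℂ z

/-- The generator labelled by `y`. -/
def gen (y : Y) : FreeStarAlg Y := sym (Sum.inl y)

/-- The conjugate-linear antiautomorphism exchanging generators with their formal adjoints. -/
def conjHom : FreeStarAlg Y →ₐ[ℂ] ConjOp (FreeStarAlg Y) :=
  FreeAlgebra.lift ℂ (fun z => (MulOpposite.op (sym z.swap) : (FreeStarAlg Y)ᵐᵒᵖ))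

instance : Star (FreeStarAlg Y) where
  star a := MulOpposite.unop (conjHom a : (FreeStarAlg Y)ᵐᵒᵖ)

theorem star_def (a : FreeStarAlg Y) :
    star a = MulOpposite.unop (conjHom a : (FreeStarAlg Y)ᵐᵒᵖ) := rfl

theorem star_sym (z : Y ⊕ Y) : star (sym z) = sym z.swap := by
  have : conjHom (sym z) = (MulOpposite.op (sym z.swap) : (FreeStarAlg Y)ᵐᵒᵖ) :=
    FreeAlgebra.lift_ι_apply _ _
  rw [star_def, this]; rfl

theorem star_scalar (c : ℂ) :
    star (algebraMap ℂ (FreeStarAlg Y) c) = algebraMap ℂ _ (starRingEnd ℂ c) := by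
  rw [star_def, AlgHom.commutes]; rfl

theorem star_mul_aux (a b : FreeStarAlg Y) : star (a * b) = star b * star a := by
  rw [star_def, map_mul]; rfl

theorem star_add_aux (a b : FreeStarAlg Y) : star (a + b) = star a + star b := by
  rw [star_def, map_add]; rfl

theorem star_star_aux (a : FreeStarAlg Y) : star (star a) = a := by
  refine FreeAlgebra.induction (R := ℂ) (X := Y ⊕ Y)
    (motive := fun a : FreeStarAlg Y => star (star a) = a) ?_ ?_ ?_ ?_ a
  · intro c
    exact (congrArg star (star_scalar c)).trans
      ((star_scalar _).trans (by rw [Complex.conj_conj]; rfl))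
  · intro z
    exact (congrArg star (star_sym z)).trans ((star_sym _).trans (by rw [Sum.swap_swap]; rfl))
  · intro a b ha hb
    exact (congrArg star (star_mul_aux a b)).trans ((star_mul_aux _ _).trans (by rw [ha, hb]; rfl))
  · intro a b ha hb
    exact (congrArg star (star_add_aux a b)).trans ((star_add_aux _ _).trans (by rw [ha, hb]; rfl))

instance : StarRing (FreeStarAlg Y) where
  star_involutive := star_star_aux
  star_mul := star_mul_aux
  star_add := star_add_aux

end FreeStarAlg

/-- The smallest enlargement of a set of relations that is stable under the involution. -/
def StarClosure {A : Type*} [Star A] (r : A → A → Prop) (a b : A) : Prop :=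
  r a b ∨ r (star a) (star b)

theorem StarClosure.star_rel {A : Type*} [InvolutiveStar A] (r : A → A → Prop) (a b : A)
    (h : StarClosure r a b) : StarClosure r (star a) (star b) := by
  rcases h with h | h
  · right; simpa using h
  · left; exact h

/-- The unital star-algebra with generators `Y` and relations `r`: the quotient of the free
star-algebra by the two-sided star-ideal generated by all `a - b` with `r a b`. -/
def PresentedStarAlg {Y : Type*} (r : FreeStarAlg Y → FreeStarAlg Y → Prop) :=
  RingQuot (StarClosure r)

variable {Y : Type*} (r : FreeStarAlg Y → FreeStarAlg Y → Prop)

instance : Ring (PresentedStarAlg r) := inferInstanceAs (Ring (RingQuot (StarClosure r)))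

instance : Algebra ℂ (PresentedStarAlg r) :=
  inferInstanceAs (Algebra ℂ (RingQuot (StarClosure r)))

instance : StarRing (PresentedStarAlg r) := RingQuot.starRing _ (StarClosure.star_rel r)

/-- The quotient map from the free star-algebra. -/
def PresentedStarAlg.mk : FreeStarAlg Y →ₐ[ℂ] PresentedStarAlg r :=
  RingQuot.mkAlgHom ℂ (StarClosure r)

theorem PresentedStarAlg.mk_star (a : FreeStarAlg Y) :
    PresentedStarAlg.mk r (star a) = star (PresentedStarAlg.mk r a) := by
  have h : ∀ b : FreeStarAlg Y, PresentedStarAlg.mk r b = (⟨Quot.mk _ b⟩ : RingQuot _) := by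
    intro b
    change ((RingQuot.mkAlgHom ℂ (StarClosure r) : FreeStarAlg Y →ₐ[ℂ] RingQuot (StarClosure r)) :
      FreeStarAlg Y →+* RingQuot (StarClosure r)) b = _
    rw [RingQuot.mkAlgHom_coe, RingQuot.mkRingHom_def]
    rfl
  rw [h, h]
  rfl

theorem PresentedStarAlg.mk_rel {a b : FreeStarAlg Y} (h : r a b) :
    PresentedStarAlg.mk r a = PresentedStarAlg.mk r b :=
  RingQuot.mkAlgHom_rel ℂ (Or.inl h)

instance : StarModule ℂ (PresentedStarAlg r) where
  star_smul c a := by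
    obtain ⟨a, rfl⟩ := RingQuot.mkAlgHom_surjective ℂ (StarClosure r) a
    have h : ∀ b : FreeStarAlg Y, star (c • b) = star c • star b := by
      intro b
      rw [Algebra.smul_def, star_mul, FreeStarAlg.star_scalar, Algebra.smul_def]
      exact (Algebra.commutes _ _).symm
    change star (c • PresentedStarAlg.mk r a) = star c • star (PresentedStarAlg.mk r a)
    rw [← map_smul, ← PresentedStarAlg.mk_star, ← PresentedStarAlg.mk_star, h, map_smul]

/-- The class of a generator. -/
def PresentedStarAlg.gen (y : Y) : PresentedStarAlg r := PresentedStarAlg.mk r (FreeStarAlg.gen y)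

/-- A state on a unital star-algebra: a normalised positive linear functional. -/
def IsState {A : Type*} [Ring A] [Algebra ℂ A] [StarRing A] (st : A →ₗ[ℂ] ℂ) : Prop :=
  st 1 = 1 ∧ ∀ a : A, 0 ≤ st (star a * a)

end StarAlgebra

/-! ## Globally hyperbolic spacetimes -/

/-- Coordinate space. -/
abbrev Coord (n : ℕ) := EuclideanSpace ℝ (Fin n)

section Spacetime

variable (n : ℕ) (M : Type*) [TopologicalSpace M] [ChartedSpace (Coord n) M]
  [IsManifold (𝓡 n) ∞ M]

/-- A time-oriented Lorentzian manifold with metric signature `(+, -, …, -)`. The time orientation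
is given by a smooth timelike vector field, declared to be future-directed. -/
structure Spacetime where
  metric : ∀ x : M, TangentSpace (𝓡 n) x →L[ℝ] TangentSpace (𝓡 n) x →L[ℝ] ℝ
  metric_smooth : ContMDiff (𝓡 n) ((𝓡 n).prod 𝓘(ℝ, Coord n →L[ℝ] Coord n →L[ℝ] ℝ)) ∞
    (fun x => TotalSpace.mk' (Coord n →L[ℝ] Coord n →L[ℝ] ℝ)
      (E := fun x : M => TangentSpace (𝓡 n) x →L[ℝ] TangentSpace (𝓡 n) x →L[ℝ] ℝ) x (metric x))
  metric_symm : ∀ x v w, metric x v w = metric x w v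
  signature : ∀ x, ∃ v, 0 < metric x v v ∧
    ∀ w, metric x v w = 0 → w ≠ 0 → metric x w w < 0
  timeField : ∀ x : M, TangentSpace (𝓡 n) x
  timeField_smooth : ContMDiff (𝓡 n) ((𝓡 n).prod 𝓘(ℝ, Coord n)) ∞
    (fun x => TotalSpace.mk' (Coord n) x (timeField x))
  timeField_timelike : ∀ x, 0 < metric x (timeField x) (timeField x)

variable {n M}

/-- The velocity of a curve. -/
def velocity (n : ℕ) {M : Type*} [TopologicalSpace M] [ChartedSpace (Coord n) M]
    (γ : ℝ → M) (t : ℝ) : TangentSpace (𝓡 n) (γ t) :=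
  mfderiv 𝓘(ℝ, ℝ) (𝓡 n) γ t (1 : ℝ)

/-- Points of the cotangent bundle: a base point together with a covector. -/
abbrev Cotangent (n : ℕ) (M : Type*) [TopologicalSpace M] [ChartedSpace (Coord n) M] :=
  Σ x : M, (TangentSpace (𝓡 n) x →L[ℝ] ℝ)

namespace Spacetime

variable (S : Spacetime n M)

/-- Future-directed timelike tangent vectors. -/
def FutureTimelike (x : M) (v : TangentSpace (𝓡 n) x) : Prop :=
  0 < S.metric x v v ∧ 0 < S.metric x (S.timeField x) v

/-- Future-directed causal tangent vectors (nonzero timelike or null). -/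
def FutureCausal (x : M) (v : TangentSpace (𝓡 n) x) : Prop :=
  v ≠ 0 ∧ 0 ≤ S.metric x v v ∧ 0 < S.metric x (S.timeField x) v

/-- `q` is joined to `p` by a smooth future-directed causal curve segment from `p` to `q`. -/
def CausalStep (p q : M) : Prop :=
  ∃ γ : ℝ → M, ContMDiff 𝓘(ℝ, ℝ) (𝓡 n) ∞ γ ∧ γ 0 = p ∧ γ 1 = q ∧
    ∀ t ∈ Icc (0 : ℝ) 1, S.FutureCausal (γ t) (velocity n γ t)

/-- The causal future `J⁺(A)`: all points of `A`, together with all points that can be reached from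
`A` along piecewise smooth future-directed causal curves. -/
def causalFuture (A : Set M) : Set M := {q | ∃ p ∈ A, Relation.ReflTransGen S.CausalStep p q}

/-- The causal past `J⁻(A)`. -/
def causalPast (A : Set M) : Set M := {q | ∃ p ∈ A, Relation.ReflTransGen S.CausalStep q p}

/-- `A` is a smooth spacelike hypersurface: locally the regular zero set of a smooth function, with
negative definite tangent spaces. -/
def IsSpacelikeHypersurface (A : Set M) : Prop :=
  ∀ p ∈ A, ∃ U ∈ 𝓝 p, ∃ φ : M → ℝ, ContMDiff (𝓡 n) 𝓘(ℝ, ℝ) ∞ φ ∧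
    A ∩ U = {x | φ x = 0} ∩ U ∧ ∀ x ∈ A ∩ U, mfderiv (𝓡 n) 𝓘(ℝ, ℝ) φ x ≠ 0 ∧
      ∀ v : TangentSpace (𝓡 n) x, mfderiv (𝓡 n) 𝓘(ℝ, ℝ) φ x v = (0 : ℝ) → v ≠ 0 →
        S.metric x v v < 0

/-- Inextendible timelike curves. Every such curve can be parametrised by the whole real line;
inextendible means that the curve has no endpoint in either direction. -/
def IsInextendibleTimelike (γ : ℝ → M) : Prop :=
  ContMDiff 𝓘(ℝ, ℝ) (𝓡 n) ∞ γ ∧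
    (∀ t, 0 < S.metric (γ t) (velocity n γ t) (velocity n γ t)) ∧
    (¬ ∃ p, Tendsto γ atTop (𝓝 p)) ∧ ¬ ∃ p, Tendsto γ atBot (𝓝 p)

/-- `A` is a Cauchy hypersurface: it is met exactly once by every inextendible timelike curve. -/
def IsCauchy (A : Set M) : Prop :=
  ∀ γ : ℝ → M, S.IsInextendibleTimelike γ → ∃! t, γ t ∈ A

/-- Global hyperbolicity: there is a smooth spacelike Cauchy hypersurface. -/
def IsGloballyHyperbolic : Prop := ∃ A : Set M, S.IsSpacelikeHypersurface A ∧ S.IsCauchy A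

/-- Lowering an index. -/
def lower (x : M) (v : TangentSpace (𝓡 n) x) : TangentSpace (𝓡 n) x →L[ℝ] ℝ := S.metric x v

theorem lower_injective (x : M) :
    Function.Injective (S.metric x : TangentSpace (𝓡 n) x → (TangentSpace (𝓡 n) x →L[ℝ] ℝ)) := by
  rw [injective_iff_map_eq_zero (S.metric x)]
  intro w hw
  by_contra h
  obtain ⟨v, -, hv⟩ := S.signature x
  have h1 : S.metric x v w = 0 := by rw [S.metric_symm, hw]; rfl
  have h2 := hv w h1 h
  rw [hw] at h2
  exact lt_irrefl _ h2

theorem lower_surjective (x : M) :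
    Function.Surjective (S.metric x : TangentSpace (𝓡 n) x → (TangentSpace (𝓡 n) x →L[ℝ] ℝ)) := by
  let e : (Coord n →L[ℝ] ℝ) ≃ₗ[ℝ] (Coord n →ₗ[ℝ] ℝ) := LinearMap.toContinuousLinearMap.symm
  let f : Coord n →ₗ[ℝ] (Coord n →L[ℝ] ℝ) := (S.metric x).toLinearMap
  have hd : Module.finrank ℝ (Coord n) = Module.finrank ℝ (Coord n →L[ℝ] ℝ) := by
    rw [e.finrank_eq]; exact (Subspace.dual_finrank_eq).symm
  have : FiniteDimensional ℝ (Coord n →L[ℝ] ℝ) := e.symm.finiteDimensional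
  exact (LinearMap.injective_iff_surjective_of_finrank_eq_finrank hd (f := f)).1
    (S.lower_injective x)

/-- Raising an index: the vector `v` with `g(v, ·) = ξ`. -/
def raise (x : M) (ξ : TangentSpace (𝓡 n) x →L[ℝ] ℝ) : TangentSpace (𝓡 n) x :=
  Function.surjInv (S.lower_surjective x) ξ

/-- The inverse metric `g⁻¹` on covectors. -/
def coMetric (x : M) (ξ η : TangentSpace (𝓡 n) x →L[ℝ] ℝ) : ℝ := η (S.raise x ξ)

/-- Nonzero null covectors that are past-pointing, that is, have negative contraction with every
future-directed timelike vector. -/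
def pastNullCone : Set (Cotangent n M) :=
  {p | p.2 ≠ 0 ∧ S.coMetric p.1 p.2 p.2 = 0 ∧ ∀ v, S.FutureTimelike p.1 v → p.2 v < 0}

/-- The tangent vector with components `v` in the coordinates of the chart at `x₀`, at the point
with coordinates `y`. -/
def coordVector (n : ℕ) {M : Type*} [TopologicalSpace M] [ChartedSpace (Coord n) M]
    (x₀ : M) (y v : Coord n) : TangentSpace (𝓡 n) ((extChartAt (𝓡 n) x₀).symm y) :=
  mfderiv 𝓘(ℝ, Coord n) (𝓡 n) (extChartAt (𝓡 n) x₀).symm y v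

/-- The metric in the coordinates of the chart at `x₀`: its value at the coordinate point `y` on
vectors with components `v` and `w`. -/
def coordMetric (x₀ : M) (y v w : Coord n) : ℝ :=
  S.metric ((extChartAt (𝓡 n) x₀).symm y) (coordVector n x₀ y v) (coordVector n x₀ y w)

/-- The metric volume `|det g|^{1/2} dy¹ ⋯ dyⁿ` on the domain of the chart at `x₀`, extended by zero
to a measure on the manifold. -/
def chartVolume [MeasurableSpace M] (x₀ : M) : Measure M :=
  ((volume.restrict (extChartAt (𝓡 n) x₀).target).withDensity (fun y : Coord n =>
    ENNReal.ofReal (Real.sqrt |(Matrix.of fun i j : Fin n =>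
      S.coordMetric x₀ y (EuclideanSpace.basisFun (Fin n) ℝ i)
        (EuclideanSpace.basisFun (Fin n) ℝ j)).det|))).map (extChartAt (𝓡 n) x₀).symm

/-- The metric volume measure. The chart volumes are the restrictions of one measure to the chart
domains; that measure is their least upper bound. -/
def metricVolume [MeasurableSpace M] : Measure M := ⨆ x₀ : M, S.chartVolume x₀

/-- The geodesic equation at parameter `s`, in the form of the Euler-Lagrange equation
`d/dτ (g(ẏ, w)) = (1/2) (∂_w g)(ẏ, ẏ)` in the coordinates of the chart at `γ s`. -/
def GeodesicAt (γ : ℝ → M) (s : ℝ) : Prop :=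
  ∀ w : Coord n,
    HasDerivAt (fun τ : ℝ => S.coordMetric (γ s) (extChartAt (𝓡 n) (γ s) (γ τ))
        (deriv (fun r => extChartAt (𝓡 n) (γ s) (γ r)) τ) w)
      ((1 / 2 : ℝ) * fderiv ℝ (fun z : Coord n => S.coordMetric (γ s) z
        (deriv (fun r => extChartAt (𝓡 n) (γ s) (γ r)) s)
        (deriv (fun r => extChartAt (𝓡 n) (γ s) (γ r)) s))
          (extChartAt (𝓡 n) (γ s) (γ s)) w) s

/-- The graph of the geodesic flow on the cotangent bundle: `q = Φ_t(p)`. -/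
def GeodesicFlow (t : ℝ) (p q : Cotangent n M) : Prop :=
  ∃ (γ : ℝ → M) (J : Set ℝ), IsOpen J ∧ J.OrdConnected ∧ 0 ∈ J ∧ t ∈ J ∧
    ContMDiffOn 𝓘(ℝ, ℝ) (𝓡 n) ∞ γ J ∧ (∀ s ∈ J, S.GeodesicAt γ s) ∧
    (⟨γ 0, S.lower (γ 0) (velocity n γ 0)⟩ : Cotangent n M) = p ∧
    (⟨γ t, S.lower (γ t) (velocity n γ t)⟩ : Cotangent n M) = q

/-- The wavefront relation `C₋`: pairs of past-pointing null covectors `(x, ξ; x', ξ')` with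
`(x, ξ) = Φ_t(x', ξ')` for some real `t`. -/
def relCminus : Set (Cotangent n M × Cotangent n M) :=
  {pq | pq.1 ∈ S.pastNullCone ∧ ∃ t : ℝ, S.GeodesicFlow t pq.2 pq.1}

end Spacetime

end Spacetime

/-! ## Sections of complex vector bundles -/

section Sections

variable (n : ℕ) {M : Type*} [TopologicalSpace M] [ChartedSpace (Coord n) M]
  (F : Type*) [NormedAddCommGroup F] [NormedSpace ℂ F]
  (V : M → Type*) [∀ x, TopologicalSpace (V x)]
  [TopologicalSpace (TotalSpace F V)] [FiberBundle F V]

/-- Smoothness of a section of a bundle. -/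
def IsSmoothSec (s : ∀ x, V x) : Prop :=
  ContMDiff (𝓡 n) ((𝓡 n).prod 𝓘(ℝ, F)) ∞ (fun x => TotalSpace.mk' F x (s x))

/-- The support of a section. -/
def secSupport {M : Type*} [TopologicalSpace M] {V : M → Type*} [∀ x, AddCommGroup (V x)]
    (s : ∀ x, V x) : Set M := closure {x | s x ≠ 0}

variable {n F V}

theorem isSmoothSec_iff {s : ∀ x, V x} : IsSmoothSec n F V s ↔
    ∀ x₀, ContMDiffAt (𝓡 n) 𝓘(ℝ, F) ∞ (fun x => (trivializationAt F V x₀ ⟨x, s x⟩).2) x₀ :=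
  forall_congr' fun x₀ => Bundle.contMDiffAt_section x₀

variable [∀ x, AddCommGroup (V x)] [∀ x, Module ℂ (V x)] [VectorBundle ℂ F V]

theorem IsSmoothSec.zero : IsSmoothSec n F V (fun x => (0 : V x)) := by
  rw [isSmoothSec_iff]
  intro x₀
  refine (contMDiffAt_const (c := (0 : F))).congr_of_eventuallyEq ?_
  filter_upwards [(trivializationAt F V x₀).open_baseSet.mem_nhds
    (mem_baseSet_trivializationAt F V x₀)] with y hy
  exact congrArg Prod.snd ((trivializationAt F V x₀).zeroSection ℂ hy)

theorem IsSmoothSec.add {s t : ∀ x, V x} (hs : IsSmoothSec n F V s) (ht : IsSmoothSec n F V t) :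
    IsSmoothSec n F V (fun x => s x + t x) := by
  rw [isSmoothSec_iff] at hs ht ⊢
  intro x₀
  refine ((hs x₀).add (ht x₀)).congr_of_eventuallyEq ?_
  filter_upwards [(trivializationAt F V x₀).open_baseSet.mem_nhds
    (mem_baseSet_trivializationAt F V x₀)] with y hy
  exact ((trivializationAt F V x₀).linear ℂ hy).map_add _ _

theorem IsSmoothSec.smul {s : ∀ x, V x} {c : M → ℂ} (hc : ContMDiff (𝓡 n) 𝓘(ℝ, ℂ) ∞ c)
    (hs : IsSmoothSec n F V s) : IsSmoothSec n F V (fun x => c x • s x) := by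
  rw [isSmoothSec_iff] at hs ⊢
  intro x₀
  have hB : ContDiff ℝ ∞ (fun p : ℂ × F => p.1 • p.2) := contDiff_fst.smul contDiff_snd
  have := hB.contDiffAt.comp_contMDiffAt ((hc x₀).prodMk_space (hs x₀))
  refine this.congr_of_eventuallyEq ?_
  filter_upwards [(trivializationAt F V x₀).open_baseSet.mem_nhds
    (mem_baseSet_trivializationAt F V x₀)] with y hy
  exact ((trivializationAt F V x₀).linear ℂ hy).map_smul _ _

variable (n F V)

/-- The space `C^∞(M; V)` of smooth sections. -/
def SmoothSec : Submodule ℂ (∀ x, V x) where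
  carrier := {s | IsSmoothSec n F V s}
  zero_mem' := IsSmoothSec.zero
  add_mem' hs ht := hs.add ht
  smul_mem' _ _ hs := IsSmoothSec.smul contMDiff_const hs

/-- The space `C_0^∞(M; V)` of smooth sections with compact support. -/
def TestSec : Submodule ℂ (∀ x, V x) where
  carrier := {s | IsSmoothSec n F V s ∧ IsCompact (secSupport s)}
  zero_mem' := ⟨IsSmoothSec.zero, by simp [secSupport]⟩
  add_mem' {s t} hs ht := ⟨hs.1.add ht.1, by
    refine (hs.2.union ht.2).of_isClosed_subset isClosed_closure ?_
    refine closure_minimal (fun x hx => ?_) (isClosed_closure.union isClosed_closure)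
    by_cases h : s x = 0
    · refine Or.inr (subset_closure fun h' => hx ?_)
      simp [h, h']
    · exact Or.inl (subset_closure h)⟩
  smul_mem' c s hs := ⟨IsSmoothSec.smul contMDiff_const hs.1, by
    refine hs.2.of_isClosed_subset isClosed_closure (closure_mono fun x hx h => hx ?_)
    simp [h]⟩

variable {n F V}

/-- Test sections are smooth sections. -/
def toSmooth : TestSec n F V →ₗ[ℂ] SmoothSec n F V where
  toFun f := ⟨f.1, f.2.1⟩
  map_add' _ _ := rfl
  map_smul' _ _ := rfl

/-- The product of a smooth real function with a smooth section. -/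
def funMul (φ : C^∞⟮𝓡 n, M; 𝓘(ℝ, ℝ), ℝ⟯) (s : SmoothSec n F V) : SmoothSec n F V :=
  ⟨fun x => ((φ x : ℝ) : ℂ) • s.1 x,
    IsSmoothSec.smul (Complex.ofRealCLM.contDiff.contMDiff.comp φ.contMDiff) s.2⟩

end Sections

/-! ## Normally hyperbolic operators and their Green operators -/

section Operators

variable {n : ℕ} {M : Type*} [TopologicalSpace M] [ChartedSpace (Coord n) M]
  [IsManifold (𝓡 n) ∞ M]
  {F : Type*} [NormedAddCommGroup F] [NormedSpace ℂ F]
  {E : M → Type*} [∀ x, AddCommGroup (E x)] [∀ x, Module ℂ (E x)] [∀ x, TopologicalSpace (E x)]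
  [TopologicalSpace (TotalSpace F E)] [FiberBundle F E] [VectorBundle ℂ F E]

/-- The commutator `[D, φ]` of an operator on sections with the multiplication by a function. -/
def commFun (D : SmoothSec n F E → SmoothSec n F E) (φ : C^∞⟮𝓡 n, M; 𝓘(ℝ, ℝ), ℝ⟯)
    (f : SmoothSec n F E) : SmoothSec n F E := D (funMul φ f) - funMul φ (D f)

variable (F E) in
/-- Normally hyperbolic operators: second-order linear differential operators with principal symbol
`-g⁻¹`. A linear operator `D` on smooth sections is a second-order differential operator with
principal symbol `σ` (with the convention `∂ ↦ iξ`) if and only if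
`[[D, φ], ψ] = -2 σ(dφ, dψ)` for all smooth functions `φ` and `ψ`. -/
structure NormallyHyperbolic (S : Spacetime n M) where
  op : SmoothSec n F E →ₗ[ℂ] SmoothSec n F E
  symbol : ∀ (φ ψ : C^∞⟮𝓡 n, M; 𝓘(ℝ, ℝ), ℝ⟯) (f : SmoothSec n F E) (x : M),
    (commFun (commFun op φ) ψ f).1 x =
      ((2 * S.coMetric x (mfderiv (𝓡 n) 𝓘(ℝ, ℝ) φ x) (mfderiv (𝓡 n) 𝓘(ℝ, ℝ) ψ x) : ℝ) : ℂ) • f.1 x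

namespace NormallyHyperbolic

variable {S : Spacetime n M} (B : NormallyHyperbolic F E S)

/-- Differential operators do not enlarge supports. -/
theorem support_subset [T2Space M] [SigmaCompactSpace M] (f : SmoothSec n F E) :
    secSupport (B.op f).1 ⊆ secSupport f.1 := by
  refine closure_minimal (fun x hx => ?_) isClosed_closure
  by_contra hxs
  apply hx
  obtain ⟨φ, h0, h1, -⟩ := exists_contMDiffMap_zero_one_of_isClosed (n := (⊤ : ℕ∞)) (𝓡 n)
    (s := secSupport f.1) (t := {x}) isClosed_closure isClosed_singleton
    (Set.disjoint_singleton_right.2 hxs)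
  have hφf : funMul φ f = 0 := by
    apply Subtype.ext
    funext y
    change ((φ y : ℝ) : ℂ) • f.1 y = 0
    by_cases hy : f.1 y = 0
    · rw [hy, smul_zero]
    · rw [h0 (subset_closure hy)]; simp
  have hz : funMul φ (0 : SmoothSec n F E) = 0 := by
    apply Subtype.ext
    funext y
    exact smul_zero _
  have hfx : f.1 x = 0 := by
    by_contra h
    exact hxs (subset_closure h)
  have key := B.symbol φ φ f x
  have hφx : φ x = 1 := h1 rfl
  rw [hfx, smul_zero] at key
  have e : commFun (commFun B.op φ) φ f = funMul φ (funMul φ (B.op f)) := by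
    simp only [commFun, hφf, hz, map_zero, sub_zero, zero_sub]
    apply Subtype.ext
    funext y
    change -(((φ y : ℝ) : ℂ) • (-(((φ y : ℝ) : ℂ) • (B.op f).1 y))) = _
    rw [smul_neg, neg_neg]
    rfl
  rw [e] at key
  change ((φ x : ℝ) : ℂ) • ((φ x : ℝ) : ℂ) • (B.op f).1 x = 0 at key
  simpa [hφx] using key

/-- The restriction of the operator to test sections. -/
def onTest [T2Space M] [SigmaCompactSpace M] : TestSec n F E →ₗ[ℂ] TestSec n F E where
  toFun f := ⟨(B.op (toSmooth f)).1, (B.op (toSmooth f)).2,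
    f.2.2.of_isClosed_subset isClosed_closure (B.support_subset (toSmooth f))⟩
  map_add' f h := Subtype.ext
    (show (B.op (toSmooth (f + h))).1 = (B.op (toSmooth f) + B.op (toSmooth h)).1 from
      congrArg Subtype.val ((congrArg B.op (map_add toSmooth f h)).trans (map_add B.op _ _)))
  map_smul' c f := Subtype.ext
    (show (B.op (toSmooth (c • f))).1 = (c • B.op (toSmooth f)).1 from
      congrArg Subtype.val ((congrArg B.op (map_smul toSmooth c f)).trans (map_smul B.op _ _)))

variable [T2Space M] [SigmaCompactSpace M]

/-- Two-sided inverses `C_0^∞ → C^∞` of the operator whose supports propagate according to `J`. -/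
def IsGreen (J : Set M → Set M) (G : TestSec n F E →ₗ[ℂ] SmoothSec n F E) : Prop :=
  (∀ f, B.op (G f) = toSmooth f) ∧ (∀ f, G (B.onTest f) = toSmooth f) ∧
    ∀ f, secSupport (G f).1 ⊆ J (secSupport f.1)

open Classical in
/-- The unique element with the property `P`, if there is one, and `0` otherwise. -/
def theUnique {A : Type*} [Zero A] (P : A → Prop) : A :=
  if h : ∃! a, P a then h.choose else 0

/-- The unique retarded fundamental solution; on globally hyperbolic spacetimes it exists. -/
def Gret : TestSec n F E →ₗ[ℂ] SmoothSec n F E := theUnique (B.IsGreen S.causalFuture)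

/-- The unique advanced fundamental solution; on globally hyperbolic spacetimes it exists. -/
def Gadv : TestSec n F E →ₗ[ℂ] SmoothSec n F E := theUnique (B.IsGreen S.causalPast)

/-- The operator `G = G_adv - G_ret`. -/
def G : TestSec n F E →ₗ[ℂ] SmoothSec n F E := B.Gadv - B.Gret

end NormallyHyperbolic

end Operators

/-! ## Dual bundles, hermitian forms and complex conjugations -/

section Bundles

variable {n : ℕ} {M : Type*} [TopologicalSpace M] [ChartedSpace (Coord n) M]

/-- The model fibre of the complex dual bundle. -/
abbrev DualModel (F : Type*) [NormedAddCommGroup F] [NormedSpace ℂ F] := F →L[ℂ] ℂ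

/-- The complex dual bundle `E^*`. -/
abbrev Dual {M : Type*} (E : M → Type*) [∀ x, AddCommGroup (E x)] [∀ x, Module ℂ (E x)]
    [∀ x, TopologicalSpace (E x)] (x : M) := E x →L[ℂ] Bundle.Trivial M ℂ x

section Semilinear

variable {F₁ : Type*} [NormedAddCommGroup F₁] [NormedSpace ℂ F₁]
  {V₁ : M → Type*} [∀ x, AddCommGroup (V₁ x)] [∀ x, Module ℂ (V₁ x)]
  [∀ x, TopologicalSpace (V₁ x)]
  [TopologicalSpace (TotalSpace F₁ V₁)] [FiberBundle F₁ V₁] [VectorBundle ℂ F₁ V₁]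
  {F₂ : Type*} [NormedAddCommGroup F₂] [NormedSpace ℂ F₂]
  {V₂ : M → Type*} [∀ x, AddCommGroup (V₂ x)] [∀ x, Module ℂ (V₂ x)]
  [∀ x, TopologicalSpace (V₂ x)]
  [TopologicalSpace (TotalSpace F₂ V₂)] [FiberBundle F₂ V₂] [VectorBundle ℂ F₂ V₂]
  [∀ x, IsTopologicalAddGroup (V₂ x)] [∀ x, ContinuousSMul ℂ (V₂ x)]

/-- Evaluation of conjugate-linear maps, as a real bilinear map. -/
def evalConj (F₁ F₂ : Type*) [NormedAddCommGroup F₁] [NormedSpace ℂ F₁]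
    [NormedAddCommGroup F₂] [NormedSpace ℂ F₂] :
    (F₁ →L⋆[ℂ] F₂) →L[ℝ] F₁ →L[ℝ] F₂ :=
  LinearMap.mkContinuous₂
    (LinearMap.mk₂ ℝ (fun (L : F₁ →L⋆[ℂ] F₂) (v : F₁) => L v)
      (fun _ _ _ => rfl) (fun _ _ _ => rfl) (fun L v w => L.map_add v w)
      (fun c L v => by
        have : c • v = (c : ℂ) • v := rfl
        rw [this, L.map_smulₛₗ, Complex.conj_ofReal]; rfl))
    1 (fun L v => by simpa using L.le_opNorm v)

/-- A smooth field of conjugate-linear maps sends smooth sections to smooth sections. -/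
theorem IsSmoothSec.apply_conj {L : ∀ x, V₁ x →L⋆[ℂ] V₂ x} {s : ∀ x, V₁ x}
    (hL : IsSmoothSec n (F₁ →L⋆[ℂ] F₂) (fun x => V₁ x →L⋆[ℂ] V₂ x) L)
    (hs : IsSmoothSec n F₁ V₁ s) : IsSmoothSec n F₂ V₂ (fun x => L x (s x)) := by
  rw [isSmoothSec_iff] at hL hs ⊢
  intro x₀
  have h1 : ContMDiffAt (𝓡 n) 𝓘(ℝ, F₁ →L[ℝ] F₂) ∞ (fun x => evalConj F₁ F₂
      (trivializationAt (F₁ →L⋆[ℂ] F₂) (fun x => V₁ x →L⋆[ℂ] V₂ x) x₀ ⟨x, L x⟩).2) x₀ :=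
    (evalConj F₁ F₂).contDiff.contDiffAt.comp_contMDiffAt (hL x₀)
  refine (h1.clm_apply (hs x₀)).congr_of_eventuallyEq ?_
  filter_upwards [(trivializationAt F₁ V₁ x₀).open_baseSet.mem_nhds
    (mem_baseSet_trivializationAt F₁ V₁ x₀), (trivializationAt F₂ V₂ x₀).open_baseSet.mem_nhds
    (mem_baseSet_trivializationAt F₂ V₂ x₀)] with y hy1 hy2
  rw [hom_trivializationAt_apply]
  change _ = (ContinuousLinearMap.inCoordinates F₁ V₁ F₂ V₂ x₀ y x₀ y (L y))
    ((trivializationAt F₁ V₁ x₀ ⟨y, s y⟩).2)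
  rw [ContinuousLinearMap.inCoordinates_eq hy1 hy2]
  simp [hy1]

end Semilinear

variable {F : Type*} [NormedAddCommGroup F] [NormedSpace ℂ F]
  {E : M → Type*} [∀ x, AddCommGroup (E x)] [∀ x, Module ℂ (E x)] [∀ x, TopologicalSpace (E x)]
  [TopologicalSpace (TotalSpace F E)] [FiberBundle F E] [VectorBundle ℂ F E]

variable (n F E) in
/-- A smooth nondegenerate hermitian form on the fibres, conjugate-linear in the first argument. -/
structure HermitianForm where
  form : ∀ x, E x →L⋆[ℂ] Dual E x
  smooth : IsSmoothSec n (F →L⋆[ℂ] DualModel F) (fun x => E x →L⋆[ℂ] Dual E x) form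
  herm : ∀ x v w, form x v w = starRingEnd ℂ (form x w v)
  nondegenerate : ∀ x v, (∀ w, form x v w = (0 : ℂ)) → v = 0

/-- The conjugate-linear map `f ↦ f^⋆` from sections of `E` to sections of `E^*`,
`⟪f^⋆, h⟫ = ⟨f, h⟩`. -/
def HermitianForm.dagger (H : HermitianForm n F E) (f : TestSec n F E) :
    TestSec n (DualModel F) (Dual E) :=
  ⟨fun x => H.form x (f.1 x), IsSmoothSec.apply_conj H.smooth f.2.1,
    f.2.2.of_isClosed_subset isClosed_closure (closure_mono fun x hx h => hx (by simp [h]))⟩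

variable [∀ x, IsTopologicalAddGroup (E x)] [∀ x, ContinuousSMul ℂ (E x)]

/-- A complex conjugation of a hermitian bundle: a smooth fibrewise conjugate-linear involution that
is compatible with the hermitian form. -/
structure Conjugation (H : HermitianForm n F E) where
  conj : ∀ x, E x →L⋆[ℂ] E x
  smooth : IsSmoothSec n (F →L⋆[ℂ] F) (fun x => E x →L⋆[ℂ] E x) conj
  involutive : ∀ x v, conj x (conj x v) = v
  compatible : ∀ x v w, H.form x (conj x v) (conj x w) = starRingEnd ℂ (H.form x v w)

namespace Conjugation

variable {H : HermitianForm n F E} (K : Conjugation H)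

/-- The conjugation on smooth sections. -/
def onSmooth (f : SmoothSec n F E) : SmoothSec n F E :=
  ⟨fun x => K.conj x (f.1 x), IsSmoothSec.apply_conj K.smooth f.2⟩

/-- The conjugation on test sections. -/
def onTest (f : TestSec n F E) : TestSec n F E :=
  ⟨fun x => K.conj x (f.1 x), IsSmoothSec.apply_conj K.smooth f.2.1,
    f.2.2.of_isClosed_subset isClosed_closure (closure_mono fun x hx h => hx (by simp [h]))⟩

/-- The complex-linear map `f ↦ f^T` from sections of `E` to sections of `E^*`,
`⟪f^T, h⟫ = ⟨conj f, h⟩`. -/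
def transpose (f : TestSec n F E) : TestSec n (DualModel F) (Dual E) := H.dagger (K.onTest f)

end Conjugation

end Bundles

/-! ## Bidistributions and wavefront sets -/

section Microlocal

variable (n : ℕ) {M : Type*} [TopologicalSpace M] [ChartedSpace (Coord n) M]
  (F₁ : Type*) [NormedAddCommGroup F₁] [NormedSpace ℂ F₁]
  (V₁ : M → Type*) [∀ x, AddCommGroup (V₁ x)] [∀ x, Module ℂ (V₁ x)]
  [∀ x, TopologicalSpace (V₁ x)]
  [TopologicalSpace (TotalSpace F₁ V₁)] [FiberBundle F₁ V₁] [VectorBundle ℂ F₁ V₁]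
  (F₂ : Type*) [NormedAddCommGroup F₂] [NormedSpace ℂ F₂]
  (V₂ : M → Type*) [∀ x, AddCommGroup (V₂ x)] [∀ x, Module ℂ (V₂ x)]
  [∀ x, TopologicalSpace (V₂ x)]
  [TopologicalSpace (TotalSpace F₂ V₂)] [FiberBundle F₂ V₂] [VectorBundle ℂ F₂ V₂]

variable {F₁ V₁} in
/-- The section read in the chart and the trivialization at `x₀`. -/
def localRep (x₀ : M) (f : TestSec n F₁ V₁) (y : Coord n) : F₁ :=
  (trivializationAt F₁ V₁ x₀
    ⟨(extChartAt (𝓡 n) x₀).symm y, f.1 ((extChartAt (𝓡 n) x₀).symm y)⟩).2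

variable {F₁ V₁} in
/-- In the chart and the trivialization at `x₀`, all derivatives of order at most `m` are bounded by
`A` on the set `L`. -/
def DerivBound (x₀ : M) (L : Set M) (m : ℕ) (f : TestSec n F₁ V₁) (A : ℝ) : Prop :=
  ∀ j ≤ m, ∀ x ∈ L, ‖iteratedFDeriv ℝ j (localRep n x₀ f) (extChartAt (𝓡 n) x₀ x)‖ ≤ A

/-- The domain on which both the chart and the trivialization at `x₀` are defined. -/
def goodDomain (x₀ : M) : Set M :=
  (chartAt (Coord n) x₀).source ∩ (trivializationAt F₁ V₁ x₀).baseSet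

/-- Distributions on `M × M` with test sections in the external tensor product of `V₁` and `V₂`,
that is, elements of `𝓓'(M × M; V₁^* ⊠ V₂^*)`, given (Schwartz kernel theorem) by their values on
the elementary tensors `f ⊗ h`: bilinear forms on `C_0^∞(M; V₁) × C_0^∞(M; V₂)` that are continuous
in the sense of distributions, i.e. bounded by `C^m` norms for arguments supported in fixed compact
subsets of coordinate domains. -/
structure Bidistribution where
  toFun : TestSec n F₁ V₁ →ₗ[ℂ] TestSec n F₂ V₂ →ₗ[ℂ] ℂ
  continuous : ∀ (x₁ x₂ : M) (L₁ L₂ : Set M), IsCompact L₁ → IsCompact L₂ →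
    L₁ ⊆ goodDomain n F₁ V₁ x₁ → L₂ ⊆ goodDomain n F₂ V₂ x₂ →
    ∃ (m : ℕ) (C : ℝ), ∀ (f : TestSec n F₁ V₁) (h : TestSec n F₂ V₂),
      secSupport f.1 ⊆ L₁ → secSupport h.1 ⊆ L₂ →
      ∀ A₁ A₂ : ℝ, 0 ≤ A₁ → 0 ≤ A₂ → DerivBound n x₁ L₁ m f A₁ → DerivBound n x₂ L₂ m h A₂ →
        ‖toFun f h‖ ≤ C * A₁ * A₂

variable {n F₁ V₁ F₂ V₂}

instance : CoeFun (Bidistribution n F₁ V₁ F₂ V₂)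
    (fun _ => TestSec n F₁ V₁ → (TestSec n F₂ V₂ →ₗ[ℂ] ℂ)) := ⟨fun W => W.toFun⟩

/-- The section `e^{-i k · x} f` in the coordinates `x` of the chart at `x₀`, for `f` supported in
the domain of this chart. -/
def oscillate [IsManifold (𝓡 n) ∞ M] (x₀ : M) (k : Coord n →L[ℝ] ℝ) (f : TestSec n F₁ V₁)
    (hf : secSupport f.1 ⊆ (chartAt (Coord n) x₀).source) : TestSec n F₁ V₁ :=
  ⟨fun x => Complex.exp (-(Complex.I * ((k (extChartAt (𝓡 n) x₀ x) : ℝ) : ℂ))) • f.1 x, by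
    rw [isSmoothSec_iff]
    intro z
    have hf' := (isSmoothSec_iff.1 f.2.1) z
    have hbase := (trivializationAt F₁ V₁ z).open_baseSet.mem_nhds
      (mem_baseSet_trivializationAt F₁ V₁ z)
    by_cases hz : z ∈ secSupport f.1
    · have hc : ContMDiffAt (𝓡 n) 𝓘(ℝ, Coord n) ∞ (extChartAt (𝓡 n) x₀) z :=
        contMDiffAt_extChartAt' (hf hz)
      have he : ContDiff ℝ ∞ (fun y : Coord n =>
          Complex.exp (-(Complex.I * ((k y : ℝ) : ℂ)))) :=
        ((contDiff_const.mul (Complex.ofRealCLM.contDiff.comp k.contDiff)).neg).cexp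
      have h1 := he.contDiffAt.comp_contMDiffAt hc
      have hB : ContDiff ℝ ∞ (fun p : ℂ × F₁ => p.1 • p.2) := contDiff_fst.smul contDiff_snd
      refine (hB.contDiffAt.comp_contMDiffAt (h1.prodMk_space hf')).congr_of_eventuallyEq ?_
      filter_upwards [hbase] with y hy
      exact ((trivializationAt F₁ V₁ z).linear ℂ hy).map_smul _ _
    · have h0 : IsSmoothSec n F₁ V₁ (fun x => (0 : V₁ x)) := IsSmoothSec.zero
      refine (isSmoothSec_iff.1 h0 z).congr_of_eventuallyEq ?_
      filter_upwards [isClosed_closure.isOpen_compl.mem_nhds hz] with y hy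
      have : f.1 y = 0 := by
        by_contra h
        exact hy (subset_closure h)
      rw [this, smul_zero],
    f.2.2.of_isClosed_subset isClosed_closure (closure_mono fun x hx h => hx (by simp [h]))⟩

variable [IsManifold (𝓡 n) ∞ M]

/-- `W` is microlocally smooth at `(p, q)`, where `p` and `q` are covectors at points `x` and `x'`:
there are neighbourhoods `U` of `x`, `U'` of `x'` and `N` of `(p, q)` such that for all test sections
`f`, `h` supported in `U`, `U'` the localised Fourier transform
`W(e^{-i t k · x} f ⊗ e^{-i t k' · x'} h)` decreases rapidly as `t → ∞`, uniformly for
`(k, k') ∈ N`. Covectors at `x` are identified with their components in the chart at `x`. -/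
def MicrolocallySmoothAt (W : Bidistribution n F₁ V₁ F₂ V₂) (p q : Cotangent n M) : Prop :=
  ∃ U ∈ 𝓝 p.1, ∃ U' ∈ 𝓝 q.1, ∃ N ∈ 𝓝 ((p.2, q.2) : (Coord n →L[ℝ] ℝ) × (Coord n →L[ℝ] ℝ)),
  ∃ (hU : U ⊆ (chartAt (Coord n) p.1).source) (hU' : U' ⊆ (chartAt (Coord n) q.1).source),
  ∀ (f : TestSec n F₁ V₁) (h : TestSec n F₂ V₂) (hf : secSupport f.1 ⊆ U)
    (hh : secSupport h.1 ⊆ U') (m : ℕ), ∃ C : ℝ, ∀ t : ℝ, 1 ≤ t → ∀ k ∈ N,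
      ‖W (oscillate p.1 (t • k.1) f (hf.trans hU)) (oscillate q.1 (t • k.2) h (hh.trans hU'))‖
        ≤ C / t ^ m

/-- The wavefront set, a set of pairs of covectors that are not both zero. -/
def WF (W : Bidistribution n F₁ V₁ F₂ V₂) : Set (Cotangent n M × Cotangent n M) :=
  {pq | ¬ (pq.1.2 = 0 ∧ pq.2.2 = 0) ∧ ¬ MicrolocallySmoothAt W pq.1 pq.2}

/-- The primed wavefront set: `(x, ξ; x', ξ') ∈ WF' W` iff `(x, ξ; x', -ξ') ∈ WF W`. -/
def WFPrime (W : Bidistribution n F₁ V₁ F₂ V₂) : Set (Cotangent n M × Cotangent n M) :=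
  {pq | ((pq.1, ⟨pq.2.1, -pq.2.2⟩) : Cotangent n M × Cotangent n M) ∈ WF W}

end Microlocal

/-! ## The field algebras and their states -/

section Fields

variable {n : ℕ} {M : Type*} [TopologicalSpace M] [ChartedSpace (Coord n) M]
  [IsManifold (𝓡 n) ∞ M] [T2Space M] [SigmaCompactSpace M] [MeasurableSpace M]
  {F : Type*} [NormedAddCommGroup F] [NormedSpace ℂ F]
  {E : M → Type*} [∀ x, AddCommGroup (E x)] [∀ x, Module ℂ (E x)] [∀ x, TopologicalSpace (E x)]
  [TopologicalSpace (TotalSpace F E)] [FiberBundle F E] [VectorBundle ℂ F E]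

/-- The integrated duality pairing `⟪u, f⟫` between sections of `E^*` and of `E`. -/
def dualPairing (S : Spacetime n M) (u : ∀ x, Dual E x) (f : ∀ x, E x) : ℂ :=
  ∫ x, (u x (f x) : ℂ) ∂S.metricVolume

/-- The integrated hermitian pairing `⟨f, h⟩` between sections of `E`. -/
def hermPairing (S : Spacetime n M) (H : HermitianForm n F E) (f h : ∀ x, E x) : ℂ :=
  ∫ x, (H.form x (f x) (h x) : ℂ) ∂S.metricVolume

variable {S : Spacetime n M}

/-- Formal self-adjointness. -/
def IsFormallySelfAdjoint (H : HermitianForm n F E) (B : NormallyHyperbolic F E S) : Prop :=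
  ∀ f h : TestSec n F E, hermPairing S H f.1 (B.onTest h).1 = hermPairing S H (B.onTest f).1 h.1

/-- `v` is the image of `u` under the formal dual operator acting on sections of `E^*`. -/
def IsFormalDualImage (B : NormallyHyperbolic F E S) (u v : TestSec n (DualModel F) (Dual E)) :
    Prop :=
  ∀ f : TestSec n F E, dualPairing S v.1 f.1 = dualPairing S u.1 (B.onTest f).1

variable (H : HermitianForm n F E) (B : NormallyHyperbolic F E S)

section Complex

variable (n F E) in
/-- Labels of the generators `Φ(u)` and `Φ^⋆(f)` of the complex field algebra. -/
abbrev ComplexLabel := TestSec n (DualModel F) (Dual E) ⊕ TestSec n F E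

/-- The symbol `Φ(u)` in the free star-algebra. -/
abbrev freePhi (u : TestSec n (DualModel F) (Dual E)) : FreeStarAlg (ComplexLabel n F E) :=
  FreeStarAlg.gen (Sum.inl u)

/-- The symbol `Φ^⋆(f)` in the free star-algebra. -/
abbrev freePhiStar (f : TestSec n F E) : FreeStarAlg (ComplexLabel n F E) :=
  FreeStarAlg.gen (Sum.inr f)

/-- The relations of the complex field algebra. -/
inductive ComplexRel : FreeStarAlg (ComplexLabel n F E) → FreeStarAlg (ComplexLabel n F E) → Prop
  | phi_linear (c : ℂ) (u v) :
      ComplexRel (freePhi (c • u + v)) (c • freePhi u + freePhi v)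
  | phiStar_linear (c : ℂ) (f h) :
      ComplexRel (freePhiStar (c • f + h)) (c • freePhiStar f + freePhiStar h)
  | adjoint (f) : ComplexRel (freePhiStar f) (star (freePhi (H.dagger f)))
  | phiStar_eqn (f) : ComplexRel (freePhiStar (B.onTest f)) 0
  | phi_eqn (u v) : IsFormalDualImage B u v → ComplexRel (freePhi v) 0
  | comm_mixed (u f) :
      ComplexRel (freePhi u * freePhiStar f - freePhiStar f * freePhi u)
        (algebraMap ℂ _ (Complex.I * dualPairing S u.1 (B.G f).1))
  | comm_phi (u v) : ComplexRel (freePhi u * freePhi v - freePhi v * freePhi u) 0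

/-- The algebra `𝒞(□)` of the quantised complex field. -/
abbrev ComplexAlg := PresentedStarAlg (ComplexRel H B)

/-- The smeared field `Φ(u)`. -/
def Phi (u : TestSec n (DualModel F) (Dual E)) : ComplexAlg H B :=
  PresentedStarAlg.gen _ (Sum.inl u)

/-- The smeared field `Φ^⋆(f)`. -/
def PhiStar (f : TestSec n F E) : ComplexAlg H B :=
  PresentedStarAlg.gen _ (Sum.inr f)

end Complex

/-- The coefficient of `z ^ m` in the formal power series `exp (-w z² / 2)`. -/
def gaussCoeff (w : ℂ) (m : ℕ) : ℂ :=
  if Even m then (-(w / 2)) ^ (m / 2) / ((m / 2).factorial : ℂ) else 0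

/-- The coefficient of `z ^ m` in the formal power series `st (exp (i z a))`. -/
def expCoeff {A : Type*} [Ring A] [Algebra ℂ A] (st : A →ₗ[ℂ] ℂ) (a : A) (m : ℕ) : ℂ :=
  Complex.I ^ m / (m.factorial : ℂ) * st (a ^ m)

variable {H B} in
/-- `st` is a gauge-invariant quasifree state of `𝒞(□)` with two-point distributions
`W₁ = W_{ΦΦ^⋆}` and `W₂ = W_{Φ^⋆Φ}`: one has
`st (e^{i(Φ(u) + Φ^⋆(f))}) = e^{-(W₁(u ⊗ f) + W₂(f ⊗ u)) / 2}` as formal series in `u` and `f`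
(the orders in `u` and `f` are separated by rescaling `u` and `f` independently). -/
def IsGaugeInvariantQuasifree (st : ComplexAlg H B →ₗ[ℂ] ℂ)
    (W₁ : Bidistribution n (DualModel F) (Dual E) F E)
    (W₂ : Bidistribution n F E (DualModel F) (Dual E)) : Prop :=
  IsState st ∧
    (∀ u f, W₁ u f = st (Phi H B u * PhiStar H B f)) ∧
    (∀ f u, W₂ f u = st (PhiStar H B f * Phi H B u)) ∧
    ∀ u f m, expCoeff st (Phi H B u + PhiStar H B f) m = gaussCoeff (W₁ u f + W₂ f u) m

/-- The two-point distributions of a complex field fulfil the Hadamard condition. -/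
def IsHadamardComplex (S : Spacetime n M) (W₁ : Bidistribution n (DualModel F) (Dual E) F E)
    (W₂ : Bidistribution n F E (DualModel F) (Dual E)) : Prop :=
  WFPrime W₁ = S.relCminus ∧ WFPrime W₂ = S.relCminus

variable [∀ x, IsTopologicalAddGroup (E x)] [∀ x, ContinuousSMul ℂ (E x)]

section Hermitian

variable {H} (K : Conjugation H)

/-- The operator commutes with the complex conjugation. -/
def CommutesWithConj : Prop := ∀ f : SmoothSec n F E, B.op (K.onSmooth f) = K.onSmooth (B.op f)

/-- The commutator distribution `G_PJ(f ⊗ h) = ⟨conj f, G h⟩`. -/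
def pauliJordan (f h : TestSec n F E) : ℂ := hermPairing S H (K.onTest f).1 (B.G h).1

/-- The symbol `Υ(f)` in the free star-algebra. -/
abbrev freeUpsilon (f : TestSec n F E) : FreeStarAlg (TestSec n F E) := FreeStarAlg.gen f

/-- The relations of the hermitian field algebra. -/
inductive HermitianRel : FreeStarAlg (TestSec n F E) → FreeStarAlg (TestSec n F E) → Prop
  | linear (c : ℂ) (f h) :
      HermitianRel (freeUpsilon (c • f + h)) (c • freeUpsilon f + freeUpsilon h)
  | adjoint (f) : HermitianRel (freeUpsilon f) (star (freeUpsilon (K.onTest f)))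
  | eqn (f) : HermitianRel (freeUpsilon (B.onTest f)) 0
  | comm (f h) :
      HermitianRel (freeUpsilon f * freeUpsilon h - freeUpsilon h * freeUpsilon f)
        (algebraMap ℂ _ (Complex.I * pauliJordan B K f h))

/-- The algebra `𝒜(□)` of the quantised hermitian field. -/
abbrev HermitianAlg := PresentedStarAlg (HermitianRel B K)

/-- The smeared field `Υ(f)`. -/
def Upsilon (f : TestSec n F E) : HermitianAlg B K := PresentedStarAlg.gen _ f

end Hermitian

variable {H B} in
/-- `st` is a quasifree state of `𝒜(□)` with two-point distribution `W`: one has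
`st (e^{i Υ(f)}) = e^{-W(f ⊗ f) / 2}` as formal series in `f`. -/
def IsQuasifree {K : Conjugation H} (st : HermitianAlg B K →ₗ[ℂ] ℂ)
    (W : Bidistribution n F E F E) : Prop :=
  IsState st ∧
    (∀ f h, W f h = st (Upsilon B K f * Upsilon B K h)) ∧
    ∀ f m, expCoeff st (Upsilon B K f) m = gaussCoeff (W f f) m

/-- The two-point distribution of a hermitian field fulfils the Hadamard condition. -/
def IsHadamardHermitian (S : Spacetime n M) (W : Bidistribution n F E F E) : Prop :=
  WFPrime W ⊆ S.relCminus

end Fields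

end QFT

end

open QFT

/-! The hermitian field already sits inside the complex field algebra: the elements `(Φ(f^T) +
Φ^⋆(f)) / √2` of `𝒞(□)` satisfy the relations of `𝒜(□)` (`hermitianPart_rel`). They therefore define
a star-homomorphism `𝒜(□) → 𝒞(□)`, and the wanted state is the pullback of `ω` along it. Positivity
comes for free, because star-homomorphisms pull states back to states (`IsState.comp_lift`).

The exponential formula on `𝒜(□)` is the one on `𝒞(□)` evaluated at `u = f^T / √2` and `f / √2`.
Gauge invariance kills the `ΦΦ` and `Φ^⋆Φ^⋆` expectations, so the pulled-back two-point function is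
the average `(W₁(f^T ⊗ h) + W₂(f ⊗ h^T)) / 2`; the commutation relation turns its first term into
`W₂(h ⊗ f^T) + i G_PJ(f ⊗ h)` (`transpose_commutator`).

The commutation relation of the hermitian part needs `G_PJ` to be antisymmetric. No Green identity
enters: a normalised functional on `𝒞(□)` makes the scalars embed, so taking adjoints in the
commutation relation shows that `G` is antihermitian, and `G` commutes with the conjugation by
uniqueness of the fundamental solutions (`pauliJordan_antisymm`).

The wavefront bound holds because `f ↦ f^T` is fibrewise, smooth and complex-linear. In coordinates
it is multiplication by a smooth matrix, so the average is again a distribution, and it commutes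
with multiplication by `e^{-ik·x}`, so the wavefront set of the average lies in the union of those
of `W₁` and `W₂`.

Uniqueness: since commutators of smeared fields are scalars, the powers `Υ(f)^m` span `𝒜(□)`
(`span_pow_UpsilonLin`), and quasifreeness prescribes the state on them. -/

noncomputable section

namespace QFT

/-! ## Homomorphisms out of presented star-algebras -/

section Lift

variable {Y A : Type*} [Ring A] [Algebra ℂ A] [StarRing A]

/-- The star-homomorphism out of the free star-algebra with prescribed values on the generators. -/
def FreeStarAlg.lift (a : Y → A) : FreeStarAlg Y →ₐ[ℂ] A :=
  FreeAlgebra.lift ℂ (Sum.elim a fun y => star (a y))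

theorem FreeStarAlg.lift_sym (a : Y → A) (z : Y ⊕ Y) :
    FreeStarAlg.lift a (FreeStarAlg.sym z) = Sum.elim a (fun y => star (a y)) z :=
  FreeAlgebra.lift_ι_apply _ _

theorem FreeStarAlg.lift_gen (a : Y → A) (y : Y) :
    FreeStarAlg.lift a (FreeStarAlg.gen y) = a y :=
  FreeStarAlg.lift_sym a _

theorem FreeStarAlg.induction {C : FreeStarAlg Y → Prop}
    (scalar : ∀ c : ℂ, C (algebraMap ℂ _ c)) (sym : ∀ z, C (FreeStarAlg.sym z))
    (mul : ∀ a b, C a → C b → C (a * b)) (add : ∀ a b, C a → C b → C (a + b))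
    (a : FreeStarAlg Y) : C a :=
  FreeAlgebra.induction (R := ℂ) (X := Y ⊕ Y) (motive := C) scalar sym mul add a

variable [StarModule ℂ A]

/-- Makes it enough to verify the listed relations: their adjoints, which `StarClosure` adds, then
hold automatically. -/
theorem FreeStarAlg.lift_star (a : Y → A) (x : FreeStarAlg Y) :
    FreeStarAlg.lift a (star x) = star (FreeStarAlg.lift a x) := by
  induction x using FreeStarAlg.induction with
  | scalar c =>
    rw [FreeStarAlg.star_scalar, AlgHom.commutes, AlgHom.commutes]
    exact algebraMap_star_comm c
  | sym z =>
    rw [FreeStarAlg.star_sym, FreeStarAlg.lift_sym, FreeStarAlg.lift_sym]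
    cases z <;> simp
  | mul x y hx hy => rw [star_mul, map_mul, map_mul, star_mul, hx, hy]
  | add x y hx hy => rw [star_add, map_add, map_add, star_add, hx, hy]

variable {r : FreeStarAlg Y → FreeStarAlg Y → Prop}

theorem PresentedStarAlg.mk_surjective : Function.Surjective (PresentedStarAlg.mk r) :=
  RingQuot.mkAlgHom_surjective ℂ (StarClosure r)

/-- The homomorphism out of a presented star-algebra determined by elements that satisfy the
relations. -/
def PresentedStarAlg.lift (a : Y → A)
    (h : ∀ x y, r x y → FreeStarAlg.lift a x = FreeStarAlg.lift a y) :
    PresentedStarAlg r →ₐ[ℂ] A :=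
  RingQuot.liftAlgHom ℂ ⟨FreeStarAlg.lift a, fun x y hxy => by
    rcases hxy with hxy | hxy
    · exact h x y hxy
    · have := h _ _ hxy
      rw [FreeStarAlg.lift_star, FreeStarAlg.lift_star] at this
      exact star_injective this⟩

variable (a : Y → A) (h : ∀ x y, r x y → FreeStarAlg.lift a x = FreeStarAlg.lift a y)

theorem PresentedStarAlg.lift_mk (x : FreeStarAlg Y) :
    PresentedStarAlg.lift a h (PresentedStarAlg.mk r x) = FreeStarAlg.lift a x :=
  RingQuot.liftAlgHom_mkAlgHom_apply ℂ _ _ x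

theorem PresentedStarAlg.lift_gen (y : Y) :
    PresentedStarAlg.lift a h (PresentedStarAlg.gen r y) = a y :=
  (PresentedStarAlg.lift_mk a h _).trans (FreeStarAlg.lift_gen a y)

theorem PresentedStarAlg.lift_star (x : PresentedStarAlg r) :
    PresentedStarAlg.lift a h (star x) = star (PresentedStarAlg.lift a h x) := by
  obtain ⟨x, rfl⟩ := PresentedStarAlg.mk_surjective x
  rw [← PresentedStarAlg.mk_star, PresentedStarAlg.lift_mk, PresentedStarAlg.lift_mk,
    FreeStarAlg.lift_star]

/-- The lift preserves products and stars, so it sends `x* x` to an element of the same form. -/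
theorem IsState.comp_lift {st : A →ₗ[ℂ] ℂ} (hst : IsState st) :
    IsState (st ∘ₗ (PresentedStarAlg.lift a h).toLinearMap) := by
  refine ⟨by simpa using hst.1, fun x => ?_⟩
  have := hst.2 (PresentedStarAlg.lift a h x)
  rw [← PresentedStarAlg.lift_star a h, ← map_mul] at this
  exact this

end Lift

/-! ## Powers of linear fields with central commutators -/

section Powers

/-- If all values of a polynomial with vector coefficients lie in a subspace, then so do its
coefficients. -/
theorem mem_of_forall_sum_pow_smul_mem {V : Type*} [AddCommGroup V] [Module ℂ V]
    (P : Submodule ℂ V) (a : ℕ → V) (N : ℕ)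
    (h : ∀ t : ℂ, ∑ i ∈ Finset.range N, t ^ i • a i ∈ P) {i : ℕ} (hi : i < N) : a i ∈ P := by
  -- A functional vanishing on `P` but not on `a i` turns the hypothesis into a scalar polynomial
  -- with all values zero, hence with zero coefficients.
  by_contra hmem
  obtain ⟨l, hl, hP⟩ := P.exists_le_ker_of_notMem hmem
  have hp : (∑ j ∈ Finset.range N, Polynomial.monomial j (l (a j)) : Polynomial ℂ) = 0 := by
    refine Polynomial.funext fun t => ?_
    have := LinearMap.mem_ker.1 (hP (h t))
    rw [map_sum] at this
    simpa [Polynomial.eval_finsetSum, mul_comm] using this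
  have := congrArg (fun p => Polynomial.coeff p i) hp
  simp [Polynomial.coeff_monomial, hi] at this
  exact hl this

theorem coeff_zero_pow_C_add_C_mul_X {A : Type*} [Ring A] (x y : A) (m : ℕ) :
    ((Polynomial.C x + Polynomial.C y * Polynomial.X) ^ m).coeff 0 = x ^ m := by
  induction m with
  | zero => simp
  | succ m ih =>
    rw [pow_succ, mul_add, ← mul_assoc, Polynomial.coeff_add, Polynomial.coeff_mul_C, ih]
    simp [pow_succ]

variable {A : Type*} [Ring A] [Algebra ℂ A]

/-- The coefficient is the sum of the `m + 1` words `x ^ i * y * x ^ (m - i)`. Moving `y` to the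
right end of each word costs only scalar multiples of powers of `x`. -/
theorem coeff_one_pow_C_add_C_mul_X {x y : A} {c : ℂ} (hc : y * x = x * y + algebraMap ℂ A c)
    (m : ℕ) : ∃ e ∈ Algebra.adjoin ℂ {x},
      ((Polynomial.C x + Polynomial.C y * Polynomial.X) ^ (m + 1)).coeff 1 =
        ((m : ℂ) + 1) • (x ^ m * y) + e := by
  have hx : x ∈ Algebra.adjoin ℂ {x} := Algebra.self_mem_adjoin_singleton ℂ x
  induction m with
  | zero => exact ⟨0, zero_mem _, by simp [Polynomial.coeff_C]⟩
  | succ m ih =>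
    obtain ⟨e, he, h⟩ := ih
    -- Each of the `m + 1` copies of `y` has to pass the new factor `x`, which leaves `c` times `x ^
    -- m`; the old remainder just picks up a factor `x`.
    refine ⟨((m : ℂ) + 1) • (x ^ m * algebraMap ℂ A c) + e * x,
      add_mem (Subalgebra.smul_mem _ (mul_mem (pow_mem hx m) (Subalgebra.algebraMap_mem _ c)) _)
        (mul_mem he hx), ?_⟩
    rw [pow_succ _ (m + 1), mul_add, ← mul_assoc, Polynomial.coeff_add, Polynomial.coeff_mul_C, h,
      Polynomial.coeff_mul_X, Polynomial.coeff_mul_C, coeff_zero_pow_C_add_C_mul_X, add_mul,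
      smul_mul_assoc, mul_assoc, hc, mul_add, ← mul_assoc, ← pow_succ, smul_add]
    push_cast
    module

/-- The values of a linear map into an algebra satisfy `U f ^ m * U h ∈ span {U k ^ j}` if all
commutators of these values are scalars. -/
theorem pow_mul_mem_span_pow {V : Type*} [AddCommGroup V] [Module ℂ V] (U : V →ₗ[ℂ] A)
    (hU : ∀ f h, ∃ c : ℂ, U f * U h - U h * U f = algebraMap ℂ A c) (f h : V) (m : ℕ) :
    U f ^ m * U h ∈ Submodule.span ℂ (range fun p : V × ℕ => U p.1 ^ p.2) := by
  set P := Submodule.span ℂ (range fun p : V × ℕ => U p.1 ^ p.2)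
  have hP : ∀ f m, U f ^ m ∈ P := fun f m => Submodule.subset_span ⟨(f, m), rfl⟩
  obtain ⟨c, hc⟩ := hU h f
  obtain ⟨e, he, hcoeff⟩ := coeff_one_pow_C_add_C_mul_X (sub_eq_iff_eq_add'.1 hc) m
  have heP : e ∈ P := by
    have : (Algebra.adjoin ℂ {U f}).toSubmodule ≤ P := by
      rw [Algebra.adjoin_eq_span, Submodule.span_le]
      intro z hz
      obtain ⟨j, rfl⟩ := Submonoid.mem_closure_singleton.1 hz
      exact hP f j
    exact this he
  -- Polarisation: `p` evaluated at a scalar `t` is `U (f + t • h) ^ (m + 1)`, which lies in `P` for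
  -- every `t`, so the coefficients of `p` lie in `P`. The one of degree 1 is `(m + 1) • (U f ^ m *
  -- U h)` modulo `P`.
  set p : Polynomial A := (Polynomial.C (U f) + Polynomial.C (U h) * Polynomial.X) ^ (m + 1)
  have hmem : p.coeff 1 ∈ P := by
    -- The length `natDegree + 2`, not `+ 1`, keeps index 1 in range even if `p` is constant.
    refine mem_of_forall_sum_pow_smul_mem P p.coeff (p.natDegree + 2) (fun t => ?_) (by omega)
    -- As `A` is noncommutative, evaluation is multiplicative only at central points; the scalar `t`
    -- is one.
    let ev := Polynomial.eval₂RingHom' (RingHom.id A) (algebraMap ℂ A t)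
      (fun a => (Algebra.commutes t a).symm)
    have hev : ev p = U (f + t • h) ^ (m + 1) := by
      have h1 : ev (Polynomial.C (U f) + Polynomial.C (U h) * Polynomial.X) = U (f + t • h) := by
        simp [ev, Polynomial.eval₂RingHom', Algebra.smul_def, Algebra.commutes t]
      rw [← h1, ← map_pow]
    have hsum : ev p = ∑ i ∈ Finset.range (p.natDegree + 2), t ^ i • p.coeff i := by
      refine (Polynomial.eval₂_eq_sum_range' (RingHom.id A) (n := p.natDegree + 2) (by omega)
        _).trans (Finset.sum_congr rfl fun i _ => ?_)
      rw [Algebra.smul_def, map_pow, ← map_pow, RingHom.id_apply, Algebra.commutes]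
    rw [← hsum, hev]
    exact hP _ _
  rw [hcoeff] at hmem
  have h2 := (Submodule.add_mem_iff_left P heP).1 hmem
  exact (Submodule.smul_mem_iff P (Nat.cast_add_one_ne_zero m)).1 h2

end Powers

section

variable {n : ℕ} {M : Type*} [TopologicalSpace M] [ChartedSpace (Coord n) M]
  {F : Type*} [NormedAddCommGroup F] [NormedSpace ℂ F]
  {E : M → Type*} [∀ x, AddCommGroup (E x)] [∀ x, Module ℂ (E x)] [∀ x, TopologicalSpace (E x)]
  [TopologicalSpace (TotalSpace F E)] [FiberBundle F E] [VectorBundle ℂ F E]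
  {H : HermitianForm n F E}

/-! ## The conjugation and the Green operators -/

section Conjugation

variable [∀ x, IsTopologicalAddGroup (E x)] [∀ x, ContinuousSMul ℂ (E x)] (K : Conjugation H)

theorem Conjugation.onSmooth_onSmooth (f : SmoothSec n F E) : K.onSmooth (K.onSmooth f) = f :=
  Subtype.ext (funext fun x => K.involutive x _)

theorem Conjugation.onTest_onTest (f : TestSec n F E) : K.onTest (K.onTest f) = f :=
  Subtype.ext (funext fun x => K.involutive x _)

/-- Equality, not just inclusion, because an involution has no kernel. The support condition on
Green operators uses it in both directions. -/
theorem Conjugation.secSupport_conj (s : ∀ x, E x) :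
    secSupport (fun x => K.conj x (s x)) = secSupport s := by
  have h : ∀ x, K.conj x (s x) = 0 ↔ s x = 0 := fun x =>
    ⟨fun h => by rw [← K.involutive x (s x), h, map_zero], fun h => by rw [h, map_zero]⟩
  simp only [secSupport, ne_eq, h]

/-- The linear operator `f ↦ conj (D (conj f))`. -/
def Conjugation.conjugate (D : TestSec n F E →ₗ[ℂ] SmoothSec n F E) :
    TestSec n F E →ₗ[ℂ] SmoothSec n F E where
  toFun f := K.onSmooth (D (K.onTest f))
  map_add' f h := by
    have h1 : K.onTest (f + h) = K.onTest f + K.onTest h :=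
      Subtype.ext (funext fun x => map_add (K.conj x) _ _)
    rw [h1, map_add]
    exact Subtype.ext (funext fun x => map_add (K.conj x) _ _)
  map_smul' c f := by
    have h1 : K.onTest (c • f) = starRingEnd ℂ c • K.onTest f :=
      Subtype.ext (funext fun x => (K.conj x).map_smulₛₗ _ _)
    rw [h1, map_smul]
    refine Subtype.ext (funext fun x => ((K.conj x).map_smulₛₗ _ _).trans ?_)
    rw [Complex.conj_conj]
    rfl

/-- The transpose `f ↦ f^T` as a linear map. -/
def Conjugation.transposeLin :
    TestSec n F E →ₗ[ℂ] TestSec n (DualModel F) (Dual E) where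
  toFun := K.transpose
  map_add' f h := Subtype.ext (funext fun x => by
    change H.form x (K.conj x (f.1 x + h.1 x)) = _
    rw [map_add, map_add]
    rfl)
  map_smul' c f := Subtype.ext (funext fun x => by
    change H.form x (K.conj x (c • f.1 x)) = _
    rw [(K.conj x).map_smulₛₗ, (H.form x).map_smulₛₗ, Complex.conj_conj]
    rfl)

theorem Conjugation.secSupport_transpose_subset (f : TestSec n F E) :
    secSupport (K.transpose f).1 ⊆ secSupport f.1 := by
  refine closure_mono fun x hx h0 => hx ?_
  change H.form x (K.conj x (f.1 x)) = 0
  rw [h0, map_zero, map_zero]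

theorem Conjugation.hermPairing_conj [IsManifold (𝓡 n) ∞ M] [MeasurableSpace M] (S : Spacetime n M)
    (s t : ∀ x, E x) :
    hermPairing S H (fun x => K.conj x (s x)) (fun x => K.conj x (t x)) =
      starRingEnd ℂ (hermPairing S H s t) := by
  unfold hermPairing
  rw [← integral_conj]
  exact integral_congr_ae (Filter.Eventually.of_forall fun x => K.compatible x _ _)

end Conjugation

variable [IsManifold (𝓡 n) ∞ M] [T2Space M] [SigmaCompactSpace M]
  {S : Spacetime n M} {B : NormallyHyperbolic F E S}

section CommutesWithConj

variable [∀ x, IsTopologicalAddGroup (E x)] [∀ x, ContinuousSMul ℂ (E x)] {K : Conjugation H}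

theorem CommutesWithConj.onTest (hK : CommutesWithConj B K) (f : TestSec n F E) :
    B.onTest (K.onTest f) = K.onTest (B.onTest f) :=
  Subtype.ext (show (B.op (K.onSmooth (toSmooth f))).1 = _ by rw [hK]; rfl)

theorem CommutesWithConj.isGreen_conjugate (hK : CommutesWithConj B K) {J : Set M → Set M}
    {D : TestSec n F E →ₗ[ℂ] SmoothSec n F E} (hD : B.IsGreen J D) :
    B.IsGreen J (K.conjugate D) := by
  refine ⟨fun f => ?_, fun f => ?_, fun f => ?_⟩
  · change B.op (K.onSmooth (D (K.onTest f))) = _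
    rw [hK, hD.1]
    exact K.onSmooth_onSmooth (toSmooth f)
  · change K.onSmooth (D (K.onTest (B.onTest f))) = _
    rw [← hK.onTest, hD.2.1]
    exact K.onSmooth_onSmooth (toSmooth f)
  · change secSupport (fun x => K.conj x ((D (K.onTest f)).1 x)) ⊆ _
    rw [K.secSupport_conj, ← K.secSupport_conj f.1]
    exact hD.2.2 (K.onTest f)

/-- Conjugating a fundamental solution gives another one with the same support property, so
uniqueness makes it invariant. If there is no unique one, `theUnique` is `0`, which is invariant
too; no existence theorem is needed. -/
theorem CommutesWithConj.conjugate_theUnique (hK : CommutesWithConj B K) (J : Set M → Set M) :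
    K.conjugate (NormallyHyperbolic.theUnique (B.IsGreen J)) =
      NormallyHyperbolic.theUnique (B.IsGreen J) := by
  unfold NormallyHyperbolic.theUnique
  split_ifs with h
  · exact h.unique (hK.isGreen_conjugate h.choose_spec.1) h.choose_spec.1
  · exact LinearMap.ext fun f => Subtype.ext (funext fun x => map_zero (K.conj x))

theorem CommutesWithConj.G_onTest (hK : CommutesWithConj B K) (f : TestSec n F E) :
    B.G (K.onTest f) = K.onSmooth (B.G f) := by
  have h : K.conjugate B.G = B.G := by
    have h1 := hK.conjugate_theUnique S.causalPast
    have h2 := hK.conjugate_theUnique S.causalFuture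
    change K.conjugate (B.Gadv - B.Gret) = _
    refine Eq.trans ?_ (congrArg₂ (· - ·) h1 h2)
    exact LinearMap.ext fun f => Subtype.ext (funext fun x => map_sub (K.conj x) _ _)
  conv_rhs => rw [← h]
  exact (K.onSmooth_onSmooth _).symm

end CommutesWithConj

/-! ## The smeared complex field -/

section ComplexField

variable [MeasurableSpace M]

variable (H B)

/-- The smeared field `Φ` as a linear map. -/
def PhiLin : TestSec n (DualModel F) (Dual E) →ₗ[ℂ] ComplexAlg H B :=
  have key : ∀ (c : ℂ) u v, Phi H B (c • u + v) = c • Phi H B u + Phi H B v := fun c u v =>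
    (PresentedStarAlg.mk_rel _ (ComplexRel.phi_linear c u v)).trans
      ((map_add _ _ _).trans (congrArg (· + Phi H B v) (map_smul _ _ _)))
  have h0 : Phi H B 0 = 0 := by simpa using key 1 0 0
  { toFun := Phi H B
    map_add' := fun u v => by simpa using key 1 u v
    map_smul' := fun c u => by simpa [h0] using key c u 0 }

/-- The smeared field `Φ^⋆` as a linear map. -/
def PhiStarLin : TestSec n F E →ₗ[ℂ] ComplexAlg H B :=
  have key : ∀ (c : ℂ) u v, PhiStar H B (c • u + v) = c • PhiStar H B u + PhiStar H B v :=
    fun c u v =>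
    (PresentedStarAlg.mk_rel _ (ComplexRel.phiStar_linear c u v)).trans
      ((map_add _ _ _).trans (congrArg (· + PhiStar H B v) (map_smul _ _ _)))
  have h0 : PhiStar H B 0 = 0 := by simpa using key 1 0 0
  { toFun := PhiStar H B
    map_add' := fun u v => by simpa using key 1 u v
    map_smul' := fun c u => by simpa [h0] using key c u 0 }

theorem star_PhiLin_dagger (f : TestSec n F E) :
    star (PhiLin H B (H.dagger f)) = PhiStarLin H B f :=
  ((PresentedStarAlg.mk_rel _ (ComplexRel.adjoint f)).trans (PresentedStarAlg.mk_star _ _)).symm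

theorem star_PhiStarLin (f : TestSec n F E) :
    star (PhiStarLin H B f) = PhiLin H B (H.dagger f) := by
  rw [← star_PhiLin_dagger, star_star]

theorem PhiStarLin_onTest (f : TestSec n F E) : PhiStarLin H B (B.onTest f) = 0 :=
  (PresentedStarAlg.mk_rel _ (ComplexRel.phiStar_eqn f)).trans (map_zero _)

variable {H B} in
theorem PhiLin_eq_zero {u v : TestSec n (DualModel F) (Dual E)} (h : IsFormalDualImage B u v) :
    PhiLin H B v = 0 :=
  (PresentedStarAlg.mk_rel _ (ComplexRel.phi_eqn u v h)).trans (map_zero _)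

theorem PhiLin_commutator_PhiStarLin (u : TestSec n (DualModel F) (Dual E)) (f : TestSec n F E) :
    PhiLin H B u * PhiStarLin H B f - PhiStarLin H B f * PhiLin H B u =
      algebraMap ℂ _ (Complex.I * dualPairing S u.1 (B.G f).1) := by
  have h := PresentedStarAlg.mk_rel _ (ComplexRel.comm_mixed (H := H) (B := B) u f)
  rw [map_sub, map_mul, map_mul, AlgHom.commutes] at h
  exact h

theorem PhiLin_commute (u v : TestSec n (DualModel F) (Dual E)) :
    PhiLin H B u * PhiLin H B v = PhiLin H B v * PhiLin H B u := by
  have h := PresentedStarAlg.mk_rel _ (ComplexRel.comm_phi (H := H) (B := B) u v)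
  rw [map_sub, map_mul, map_mul, map_zero] at h
  exact sub_eq_zero.1 h

theorem PhiStarLin_commute (f h : TestSec n F E) :
    PhiStarLin H B f * PhiStarLin H B h = PhiStarLin H B h * PhiStarLin H B f := by
  rw [← star_PhiLin_dagger, ← star_PhiLin_dagger, ← star_mul, ← star_mul, PhiLin_commute]

variable {H B}

/-- Excludes the zero algebra, so identities between scalars in the algebra can be read in `ℂ`. -/
theorem algebraMap_injective_of_state {A : Type*} [Ring A] [Algebra ℂ A] (st : A →ₗ[ℂ] ℂ)
    (h1 : st 1 = 1) : Function.Injective (algebraMap ℂ A) := fun c d h => by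
  have := congrArg st h
  simpa [Algebra.algebraMap_eq_smul_one, h1] using this

/-- If the complex field algebra admits a normalised functional, then `G` is antihermitian. -/
theorem hermPairing_G_antihermitian {st : ComplexAlg H B →ₗ[ℂ] ℂ} (h1 : st 1 = 1)
    (f h : TestSec n F E) : hermPairing S H f.1 (B.G h).1 =
      -starRingEnd ℂ (hermPairing S H h.1 (B.G f).1) := by
  have e1 : PhiLin H B (H.dagger f) * PhiStarLin H B h - PhiStarLin H B h * PhiLin H B (H.dagger f)
      = algebraMap ℂ _ (Complex.I * hermPairing S H f.1 (B.G h).1) :=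
    PhiLin_commutator_PhiStarLin H B (H.dagger f) h
  have e2 : PhiLin H B (H.dagger h) * PhiStarLin H B f - PhiStarLin H B f * PhiLin H B (H.dagger h)
      = algebraMap ℂ _ (Complex.I * hermPairing S H h.1 (B.G f).1) :=
    PhiLin_commutator_PhiStarLin H B (H.dagger h) f
  -- The adjoint exchanges `Φ(h^⋆)` with `Φ^⋆(h)` and `Φ^⋆(f)` with `Φ(f^⋆)`, so the starred
  -- commutator is again the commutator in `e1`.
  have e3 := congrArg star e2
  rw [star_sub, star_mul, star_mul, star_PhiLin_dagger, star_PhiStarLin, e1,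
    ← algebraMap_star_comm] at e3
  have e4 := algebraMap_injective_of_state st h1 e3
  have e5 : star (Complex.I * hermPairing S H h.1 (B.G f).1) =
      Complex.I * -starRingEnd ℂ (hermPairing S H h.1 (B.G f).1) := by
    simp
  exact mul_left_cancel₀ Complex.I_ne_zero (e4.trans e5)

end ComplexField

/-! ### Antisymmetry of the Pauli-Jordan distribution and the field equation for transposes -/

section Transpose

variable [MeasurableSpace M] [∀ x, IsTopologicalAddGroup (E x)] [∀ x, ContinuousSMul ℂ (E x)]
  {K : Conjugation H}

/-- If the complex field algebra admits a normalised functional, then the Pauli-Jordan distribution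
is antisymmetric. -/
theorem pauliJordan_antisymm (hK : CommutesWithConj B K) {st : ComplexAlg H B →ₗ[ℂ] ℂ}
    (h1 : st 1 = 1) (f h : TestSec n F E) : pauliJordan B K f h = -pauliJordan B K h f := by
  unfold pauliJordan
  rw [hermPairing_G_antihermitian h1, hK.G_onTest, ← K.hermPairing_conj S]
  refine congrArg Neg.neg (congrArg (hermPairing S H (K.onTest h).1) ?_)
  exact congrArg Subtype.val (K.onSmooth_onSmooth (B.G f))

theorem isFormalDualImage_transpose (hB : IsFormallySelfAdjoint H B) (hK : CommutesWithConj B K)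
    (f : TestSec n F E) : IsFormalDualImage B (K.transpose f) (K.transpose (B.onTest f)) := by
  intro h
  have := hB (K.onTest f) h
  rw [hK.onTest] at this
  exact this.symm

end Transpose

end

section

variable {n : ℕ} {M : Type*} [TopologicalSpace M] [ChartedSpace (Coord n) M]
  [IsManifold (𝓡 n) ∞ M] [T2Space M] [SigmaCompactSpace M] [MeasurableSpace M]
  {F : Type*} [NormedAddCommGroup F] [NormedSpace ℂ F]
  {E : M → Type*} [∀ x, AddCommGroup (E x)] [∀ x, Module ℂ (E x)] [∀ x, TopologicalSpace (E x)]
  [TopologicalSpace (TotalSpace F E)] [FiberBundle F E] [VectorBundle ℂ F E]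
  {S : Spacetime n M} {H : HermitianForm n F E} {B : NormallyHyperbolic F E S}

/-! ## Two-point functions of gauge-invariant quasifree states -/

section TwoPoint

variable {st : ComplexAlg H B →ₗ[ℂ] ℂ} {W₁ : Bidistribution n (DualModel F) (Dual E) F E}
  {W₂ : Bidistribution n F E (DualModel F) (Dual E)}

/-- This is the order-two coefficient of the exponential formula. -/
theorem IsGaugeInvariantQuasifree.sq (hst : IsGaugeInvariantQuasifree st W₁ W₂)
    (u : TestSec n (DualModel F) (Dual E)) (f : TestSec n F E) :
    st ((PhiLin H B u + PhiStarLin H B f) ^ 2) = W₁ u f + W₂ f u := by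
  have h := hst.2.2.2 u f 2
  simp only [expCoeff, gaussCoeff, Complex.I_sq, even_two, if_true, Nat.factorial] at h
  norm_num at h
  change st ((Phi H B u + PhiStar H B f) ^ 2) = _
  linear_combination 2 * h

/-- Polarisation: commutativity merges the two cross terms of `U (u + v) ^ 2`. -/
theorem map_mul_eq_zero_of_map_sq {V A : Type*} [AddCommGroup V] [Module ℂ V] [Ring A]
    [Algebra ℂ A] (st : A →ₗ[ℂ] ℂ) (U : V →ₗ[ℂ] A) (hU : ∀ u v, U u * U v = U v * U u)
    (h : ∀ u, st (U u ^ 2) = 0) (u v : V) : st (U u * U v) = 0 := by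
  have h1 := h (u + v)
  rw [map_add, sq, add_mul, mul_add, mul_add, ← sq, ← sq, hU v u] at h1
  simp only [map_add, h] at h1
  linear_combination h1 / 2

/-- With second argument `0` the exponent `W₁(u ⊗ f) + W₂(f ⊗ u)` vanishes, hence so does the
expectation of `Φ(u)²`; this is where gauge invariance enters. -/
theorem IsGaugeInvariantQuasifree.phi_phi (hst : IsGaugeInvariantQuasifree st W₁ W₂)
    (u v : TestSec n (DualModel F) (Dual E)) : st (PhiLin H B u * PhiLin H B v) = 0 :=
  map_mul_eq_zero_of_map_sq st _ (PhiLin_commute H B)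
    (fun u => by simpa using hst.sq u 0) u v

theorem IsGaugeInvariantQuasifree.phiStar_phiStar (hst : IsGaugeInvariantQuasifree st W₁ W₂)
    (f h : TestSec n F E) : st (PhiStarLin H B f * PhiStarLin H B h) = 0 :=
  map_mul_eq_zero_of_map_sq st _ (PhiStarLin_commute H B)
    (fun f => by simpa using hst.sq 0 f) f h

variable [∀ x, IsTopologicalAddGroup (E x)] [∀ x, ContinuousSMul ℂ (E x)] (K : Conjugation H)

theorem IsGaugeInvariantQuasifree.transpose_commutator (hst : IsGaugeInvariantQuasifree st W₁ W₂)
    (f h : TestSec n F E) :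
    W₁ (K.transpose f) h = W₂ h (K.transpose f) + Complex.I * pauliJordan B K f h := by
  have e := congrArg st (PhiLin_commutator_PhiStarLin H B (K.transpose f) h)
  rw [map_sub, Algebra.algebraMap_eq_smul_one, map_smul, hst.1.1, smul_eq_mul, mul_one] at e
  rw [hst.2.1, hst.2.2.1]
  exact sub_eq_iff_eq_add'.1 e

end TwoPoint

variable [∀ x, IsTopologicalAddGroup (E x)] [∀ x, ContinuousSMul ℂ (E x)] {K : Conjugation H}

/-! ## The hermitian field algebra -/

section HermitianField

variable (B K)

/-- The smeared hermitian field as a linear map. -/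
def UpsilonLin : TestSec n F E →ₗ[ℂ] HermitianAlg B K :=
  have key : ∀ (c : ℂ) f h, Upsilon B K (c • f + h) = c • Upsilon B K f + Upsilon B K h :=
    fun c f h =>
    (PresentedStarAlg.mk_rel _ (HermitianRel.linear c f h)).trans
      ((map_add _ _ _).trans (congrArg (· + Upsilon B K h) (map_smul _ _ _)))
  have h0 : Upsilon B K 0 = 0 := by simpa using key 1 0 0
  { toFun := Upsilon B K
    map_add' := fun u v => by simpa using key 1 u v
    map_smul' := fun c u => by simpa [h0] using key c u 0 }

theorem star_UpsilonLin (f : TestSec n F E) :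
    star (UpsilonLin B K f) = UpsilonLin B K (K.onTest f) := by
  have h : UpsilonLin B K f = star (UpsilonLin B K (K.onTest f)) :=
    (PresentedStarAlg.mk_rel _ (HermitianRel.adjoint f)).trans (PresentedStarAlg.mk_star _ _)
  rw [h, star_star]

theorem UpsilonLin_commutator (f h : TestSec n F E) :
    UpsilonLin B K f * UpsilonLin B K h - UpsilonLin B K h * UpsilonLin B K f =
      algebraMap ℂ _ (Complex.I * pauliJordan B K f h) := by
  have h := PresentedStarAlg.mk_rel _ (HermitianRel.comm (B := B) (K := K) f h)
  rw [map_sub, map_mul, map_mul, AlgHom.commutes] at h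
  exact h

/-- The hermitian field algebra is spanned by the powers of the smeared field. -/
theorem span_pow_UpsilonLin :
    Submodule.span ℂ (range fun p : TestSec n F E × ℕ => UpsilonLin B K p.1 ^ p.2) = ⊤ := by
  set P := Submodule.span ℂ (range fun p : TestSec n F E × ℕ => UpsilonLin B K p.1 ^ p.2)
  -- It suffices that `P` contains `1` and is stable under right multiplication by smeared fields.
  have hmul : ∀ h, ∀ b ∈ P, b * UpsilonLin B K h ∈ P := by
    intro h b hb
    induction hb using Submodule.span_induction with
    | mem b hb =>
      obtain ⟨⟨f, m⟩, rfl⟩ := hb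
      exact pow_mul_mem_span_pow _ (fun f h => ⟨_, UpsilonLin_commutator B K f h⟩) f h m
    | zero => simp
    | add b c _ _ hb hc => rw [add_mul]; exact add_mem hb hc
    | smul c b _ hb => rw [smul_mul_assoc]; exact P.smul_mem c hb
  -- Quantifying over `b` lets the induction pass through products, as `b * (a * c) = (b * a) * c`.
  have hall : ∀ a : FreeStarAlg (TestSec n F E), ∀ b ∈ P, b * PresentedStarAlg.mk _ a ∈ P := by
    intro a
    induction a using FreeStarAlg.induction with
    | scalar c =>
      intro b hb
      rw [AlgHom.commutes, ← Algebra.commutes, ← Algebra.smul_def]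
      exact P.smul_mem c hb
    | sym z =>
      intro b hb
      rcases z with f | f
      · exact hmul f b hb
      · have h : PresentedStarAlg.mk (HermitianRel B K) (FreeStarAlg.sym (Sum.inr f)) =
            star (UpsilonLin B K f) := by
          rw [← Sum.swap_inl, ← FreeStarAlg.star_sym, PresentedStarAlg.mk_star]
          rfl
        rw [h, star_UpsilonLin]
        exact hmul _ b hb
    | mul a c ha hc =>
      intro b hb
      rw [map_mul, ← mul_assoc]
      exact hc _ (ha b hb)
    | add a c ha hc =>
      intro b hb
      rw [map_add, mul_add]
      exact add_mem (ha b hb) (hc b hb)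
  refine Submodule.eq_top_iff'.2 fun a => ?_
  obtain ⟨a, rfl⟩ := PresentedStarAlg.mk_surjective a
  simpa using hall a 1 (Submodule.subset_span ⟨(0, 0), pow_zero _⟩)

variable {B K}

/-- A quasifree state is determined by its two-point distribution. -/
theorem IsQuasifree.unique {st st' : HermitianAlg B K →ₗ[ℂ] ℂ} {W : Bidistribution n F E F E}
    (h : IsQuasifree st W) (h' : IsQuasifree st' W) : st = st' := by
  refine LinearMap.ext_on (span_pow_UpsilonLin B K) ?_
  rintro _ ⟨⟨f, m⟩, rfl⟩
  have e : expCoeff st (Upsilon B K f) m = expCoeff st' (Upsilon B K f) m :=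
    (h.2.2 f m).trans (h'.2.2 f m).symm
  exact mul_left_cancel₀ (div_ne_zero (pow_ne_zero m Complex.I_ne_zero)
    (Nat.cast_ne_zero.2 m.factorial_ne_zero)) e

end HermitianField

/-! ## The hermitian field inside the complex field algebra -/

section Embedding

theorem inv_sqrt_two_mul_self :
    ((Real.sqrt 2 : ℝ) : ℂ)⁻¹ * ((Real.sqrt 2 : ℝ) : ℂ)⁻¹ = 1 / 2 := by
  rw [← mul_inv, ← Complex.ofReal_mul, Real.mul_self_sqrt (by norm_num)]
  norm_num

variable (B K)

/-- The hermitian part `(Φ(f^T) + Φ^⋆(f)) / √2` of the complex field. -/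
def hermitianPart : TestSec n F E →ₗ[ℂ] ComplexAlg H B :=
  ((Real.sqrt 2 : ℝ) : ℂ)⁻¹ • (PhiLin H B ∘ₗ K.transposeLin + PhiStarLin H B)

theorem hermitianPart_apply (f : TestSec n F E) : hermitianPart B K f =
    ((Real.sqrt 2 : ℝ) : ℂ)⁻¹ • (PhiLin H B (K.transpose f) + PhiStarLin H B f) := rfl

/-- The adjoint exchanges the two summands: `(conj f)^T = f^⋆`, and `Φ(f^⋆)` and `Φ^⋆(f)` are
adjoint to each other. The factor `1 / √2` is real. -/
theorem star_hermitianPart (f : TestSec n F E) :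
    star (hermitianPart B K (K.onTest f)) = hermitianPart B K f := by
  have h : K.transpose (K.onTest f) = H.dagger f := by
    rw [Conjugation.transpose, K.onTest_onTest]
  have hs : star (((Real.sqrt 2 : ℝ) : ℂ)⁻¹) = ((Real.sqrt 2 : ℝ) : ℂ)⁻¹ := by
    rw [star_inv₀]
    exact congrArg _ (Complex.conj_ofReal _)
  rw [hermitianPart_apply, hermitianPart_apply, star_smul, star_add, h, star_PhiLin_dagger,
    star_PhiStarLin, hs, add_comm]
  rfl

theorem hermitianPart_mul (f h : TestSec n F E) :
    hermitianPart B K f * hermitianPart B K h = (1 / 2 : ℂ) •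
      (PhiLin H B (K.transpose f) * PhiLin H B (K.transpose h) +
        PhiLin H B (K.transpose f) * PhiStarLin H B h +
        (PhiStarLin H B f * PhiLin H B (K.transpose h) + PhiStarLin H B f * PhiStarLin H B h)) := by
  rw [hermitianPart_apply, hermitianPart_apply, smul_mul_smul_comm, inv_sqrt_two_mul_self, add_mul,
    mul_add, mul_add]

variable {B K}

/-- The `ΦΦ` and `Φ^⋆Φ^⋆` commutators vanish. The two mixed ones agree by antisymmetry of `G_PJ`,
and the factor `(1 / √2)² = 1 / 2` reduces them to one; this fixes the normalisation. -/
theorem hermitianPart_commutator (hK : CommutesWithConj B K) {st : ComplexAlg H B →ₗ[ℂ] ℂ}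
    (h1 : st 1 = 1) (f h : TestSec n F E) :
    hermitianPart B K f * hermitianPart B K h - hermitianPart B K h * hermitianPart B K f =
      algebraMap ℂ _ (Complex.I * pauliJordan B K f h) := by
  have e1 : PhiLin H B (K.transpose f) * PhiStarLin H B h -
      PhiStarLin H B h * PhiLin H B (K.transpose f) =
        algebraMap ℂ _ (Complex.I * pauliJordan B K f h) :=
    PhiLin_commutator_PhiStarLin H B (K.transpose f) h
  have e2 : PhiLin H B (K.transpose h) * PhiStarLin H B f -
      PhiStarLin H B f * PhiLin H B (K.transpose h) =
        -algebraMap ℂ _ (Complex.I * pauliJordan B K f h) := by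
    rw [← map_neg, ← mul_neg, ← pauliJordan_antisymm hK h1 h f]
    exact PhiLin_commutator_PhiStarLin H B (K.transpose h) f
  rw [hermitianPart_mul, hermitianPart_mul, ← smul_sub,
    PhiLin_commute H B (K.transpose f) (K.transpose h), PhiStarLin_commute H B f h,
    sub_eq_iff_eq_add.1 e1, sub_eq_iff_eq_add.1 e2]
  module

theorem hermitianPart_onTest (hB : IsFormallySelfAdjoint H B) (hK : CommutesWithConj B K)
    (f : TestSec n F E) : hermitianPart B K (B.onTest f) = 0 := by
  rw [hermitianPart_apply, PhiStarLin_onTest, PhiLin_eq_zero (isFormalDualImage_transpose hB hK f),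
    add_zero, smul_zero]

theorem hermitianPart_rel (hB : IsFormallySelfAdjoint H B) (hK : CommutesWithConj B K)
    {st : ComplexAlg H B →ₗ[ℂ] ℂ} (h1 : st 1 = 1) (x y : FreeStarAlg (TestSec n F E))
    (h : HermitianRel B K x y) :
    FreeStarAlg.lift (hermitianPart B K) x = FreeStarAlg.lift (hermitianPart B K) y := by
  cases h with
  | linear c f h =>
    simp only [map_add, map_smul, FreeStarAlg.lift_gen]
  | adjoint f =>
    rw [FreeStarAlg.lift_star, FreeStarAlg.lift_gen, FreeStarAlg.lift_gen, star_hermitianPart]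
  | eqn f =>
    rw [FreeStarAlg.lift_gen, hermitianPart_onTest hB hK, map_zero]
  | comm f h =>
    rw [map_sub, map_mul, map_mul, AlgHom.commutes, FreeStarAlg.lift_gen, FreeStarAlg.lift_gen,
      hermitianPart_commutator hK h1]

/-- The pullback of a gauge-invariant quasifree state to the hermitian field algebra is quasifree. -/
theorem IsGaugeInvariantQuasifree.exists_isQuasifree (hB : IsFormallySelfAdjoint H B)
    (hK : CommutesWithConj B K) {st : ComplexAlg H B →ₗ[ℂ] ℂ}
    {W₁ : Bidistribution n (DualModel F) (Dual E) F E}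
    {W₂ : Bidistribution n F E (DualModel F) (Dual E)}
    (hst : IsGaugeInvariantQuasifree st W₁ W₂) (W : Bidistribution n F E F E)
    (hW : ∀ f h, W f h = (1 / 2 : ℂ) * (W₁ (K.transpose f) h + W₂ f (K.transpose h))) :
    ∃ st' : HermitianAlg B K →ₗ[ℂ] ℂ, IsQuasifree st' W := by
  let φ := PresentedStarAlg.lift (hermitianPart B K) (hermitianPart_rel hB hK hst.1.1)
  have hφ : ∀ f, φ (Upsilon B K f) = hermitianPart B K f := PresentedStarAlg.lift_gen _ _
  refine ⟨st ∘ₗ φ.toLinearMap, hst.1.comp_lift _ _, fun f h => ?_, fun f m => ?_⟩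
  · change W f h = st (φ (Upsilon B K f * Upsilon B K h))
    rw [map_mul, hφ, hφ, hermitianPart_mul, map_smul, map_add, map_add, map_add, hst.phi_phi,
      hst.phiStar_phiStar, zero_add, add_zero, hW, hst.2.1, hst.2.2.1]
    rfl
  -- Giving one factor `1 / √2` to each argument puts `s * s = 1 / 2` in front of both bilinear
  -- terms, which is the prefactor in `hW`.
  · set s : ℂ := ((Real.sqrt 2 : ℝ) : ℂ)⁻¹ with hs
    have e : hermitianPart B K f = Phi H B (s • K.transpose f) + PhiStar H B (s • f) := by
      rw [hermitianPart_apply, smul_add, ← map_smul, ← map_smul]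
      rfl
    have h := hst.2.2.2 (s • K.transpose f) (s • f) m
    have hw : W₁ (s • K.transpose f) (s • f) + W₂ (s • f) (s • K.transpose f) = W f f := by
      simp only [map_smul, LinearMap.smul_apply, smul_eq_mul, hW]
      rw [← mul_assoc, ← mul_assoc, hs, inv_sqrt_two_mul_self, mul_add]
    rw [hw, ← e] at h
    rw [← h]
    change _ * st (φ (Upsilon B K f ^ m)) = _
    rw [map_pow, hφ]
    rfl

end Embedding

end

section

variable {n : ℕ} {M : Type*} [TopologicalSpace M] [ChartedSpace (Coord n) M]

/-! ## Derivatives of matrix products -/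

theorem exists_bound_iteratedFDeriv_clm_apply {V G₁ G₂ : Type*} [NormedAddCommGroup V]
    [NormedSpace ℝ V] [NormedAddCommGroup G₁] [NormedSpace ℝ G₁] [NormedAddCommGroup G₂]
    [NormedSpace ℝ G₂] {U L : Set V} (hU : IsOpen U) {T : V → G₁ →L[ℝ] G₂}
    (hT : ContDiffOn ℝ ∞ T U) (hL : IsCompact L) (hLU : L ⊆ U) (m : ℕ) :
    ∃ D : ℝ, 0 ≤ D ∧ ∀ (g : V → G₁) (A : ℝ), 0 ≤ A → ContDiffOn ℝ ∞ g U → ∀ y ∈ L,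
      (∀ j ≤ m, ‖iteratedFDeriv ℝ j g y‖ ≤ A) →
        ∀ j ≤ m, ‖iteratedFDeriv ℝ j (fun z => T z (g z)) y‖ ≤ D * A := by
  have hbd : ∀ i : ℕ, ∃ C : ℝ, ∀ y ∈ L, ‖iteratedFDerivWithin ℝ i T U y‖ ≤ C := fun i =>
    hL.exists_bound_of_continuousOn ((hT.continuousOn_iteratedFDerivWithin
      (by exact_mod_cast le_top) hU.uniqueDiffOn).mono hLU)
  choose C hC using hbd
  -- Summing the Leibniz constants over all orders up to `m` gives one constant for all of them.
  -- Absolute values are taken since `C i` may be negative when `L` is empty.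
  refine ⟨∑ j ∈ Finset.range (m + 1), ∑ i ∈ Finset.range (j + 1), (j.choose i : ℝ) * |C i|,
    by positivity, fun g A hA hg y hy hgA j hj => ?_⟩
  rw [← iteratedFDerivWithin_of_isOpen j hU (hLU hy)]
  refine (norm_iteratedFDerivWithin_clm_apply hT hg hU.uniqueDiffOn (hLU hy)
    (by exact_mod_cast le_top)).trans ?_
  have hterm : ∑ i ∈ Finset.range (j + 1), (j.choose i : ℝ) * ‖iteratedFDerivWithin ℝ i T U y‖ *
      ‖iteratedFDerivWithin ℝ (j - i) g U y‖ ≤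
      (∑ i ∈ Finset.range (j + 1), (j.choose i : ℝ) * |C i|) * A := by
    rw [Finset.sum_mul]
    refine Finset.sum_le_sum fun i _ => ?_
    have h1 : ‖iteratedFDerivWithin ℝ i T U y‖ ≤ |C i| := (hC i y hy).trans (le_abs_self _)
    have h2 : ‖iteratedFDerivWithin ℝ (j - i) g U y‖ ≤ A := by
      rw [iteratedFDerivWithin_of_isOpen _ hU (hLU hy)]
      exact hgA (j - i) ((Nat.sub_le _ _).trans hj)
    gcongr
  refine hterm.trans (mul_le_mul_of_nonneg_right ?_ hA)
  exact Finset.single_le_sum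
    (f := fun j => ∑ i ∈ Finset.range (j + 1), (j.choose i : ℝ) * |C i|)
    (fun _ _ => by positivity) (Finset.mem_range.2 (Nat.lt_succ_of_le hj))

theorem exists_bound_iteratedFDeriv_sum_smul {V G₁ G₂ ι : Type*} [NormedAddCommGroup V]
    [NormedSpace ℝ V] [NormedAddCommGroup G₁] [NormedSpace ℂ G₁] [NormedAddCommGroup G₂]
    [NormedSpace ℂ G₂] [Fintype ι] {U L : Set V} (hU : IsOpen U) {τ : ι → V → ℂ}
    (hτ : ∀ i, ContDiffOn ℝ ∞ (τ i) U) (Q : ι → G₁ →L[ℂ] G₂) (hL : IsCompact L) (hLU : L ⊆ U)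
    (m : ℕ) :
    ∃ D : ℝ, 0 ≤ D ∧ ∀ (g : V → G₁) (A : ℝ), 0 ≤ A → ContDiffOn ℝ ∞ g U → ∀ y ∈ L,
      (∀ j ≤ m, ‖iteratedFDeriv ℝ j g y‖ ≤ A) →
        ∀ j ≤ m, ‖iteratedFDeriv ℝ j (fun z => ∑ i, τ i z • Q i (g z)) y‖ ≤ D * A := by
  -- The coefficient maps are complex-linear while the derivatives are real, so scalars are
  -- restricted before the Leibniz rule is applied.
  have hT : ContDiffOn ℝ ∞
      (fun y => ContinuousLinearMap.restrictScalarsL ℂ G₁ G₂ ℝ ℝ (∑ i, τ i y • Q i)) U :=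
    (ContinuousLinearMap.contDiff _).comp_contDiffOn
      (ContDiffOn.sum fun i _ => (hτ i).smul_const (Q i))
  have key : ∀ (g : V → G₁) (z : V), ContinuousLinearMap.restrictScalarsL ℂ G₁ G₂ ℝ ℝ
      (∑ i, τ i z • Q i) (g z) = ∑ i, τ i z • Q i (g z) := fun g z => by
    simp [sum_apply]
  simpa only [key] using exists_bound_iteratedFDeriv_clm_apply hU hT hL hLU m

/-! ## Smoothness at a point -/

section Pointwise

variable {F₁ : Type*} [NormedAddCommGroup F₁] [NormedSpace ℂ F₁]
  {V₁ : M → Type*} [∀ x, AddCommGroup (V₁ x)] [∀ x, Module ℂ (V₁ x)]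
  [∀ x, TopologicalSpace (V₁ x)]
  [TopologicalSpace (TotalSpace F₁ V₁)] [FiberBundle F₁ V₁] [VectorBundle ℂ F₁ V₁]
  {F₂ : Type*} [NormedAddCommGroup F₂] [NormedSpace ℂ F₂]
  {V₂ : M → Type*} [∀ x, AddCommGroup (V₂ x)] [∀ x, Module ℂ (V₂ x)]
  [∀ x, TopologicalSpace (V₂ x)]
  [TopologicalSpace (TotalSpace F₂ V₂)] [FiberBundle F₂ V₂] [VectorBundle ℂ F₂ V₂]
  [∀ x, IsTopologicalAddGroup (V₂ x)] [∀ x, ContinuousSMul ℂ (V₂ x)]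

/-- A pointwise form of `IsSmoothSec.apply_conj`, needed for local frames, which are smooth only
over the domain of a trivialization. -/
theorem contMDiffAt_apply_conj {L : ∀ x, V₁ x →L⋆[ℂ] V₂ x} {s : ∀ x, V₁ x}
    (hL : IsSmoothSec n (F₁ →L⋆[ℂ] F₂) (fun x => V₁ x →L⋆[ℂ] V₂ x) L) {x₀ : M}
    (hs : ContMDiffAt (𝓡 n) 𝓘(ℝ, F₁) ∞ (fun x => (trivializationAt F₁ V₁ x₀ ⟨x, s x⟩).2) x₀) :
    ContMDiffAt (𝓡 n) 𝓘(ℝ, F₂) ∞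
      (fun x => (trivializationAt F₂ V₂ x₀ ⟨x, L x (s x)⟩).2) x₀ := by
  have h1 : ContMDiffAt (𝓡 n) 𝓘(ℝ, F₁ →L[ℝ] F₂) ∞ (fun x => evalConj F₁ F₂
      (trivializationAt (F₁ →L⋆[ℂ] F₂) (fun x => V₁ x →L⋆[ℂ] V₂ x) x₀ ⟨x, L x⟩).2) x₀ :=
    (evalConj F₁ F₂).contDiff.contDiffAt.comp_contMDiffAt (isSmoothSec_iff.1 hL x₀)
  refine (h1.clm_apply hs).congr_of_eventuallyEq ?_
  filter_upwards [(trivializationAt F₁ V₁ x₀).open_baseSet.mem_nhds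
    (mem_baseSet_trivializationAt F₁ V₁ x₀), (trivializationAt F₂ V₂ x₀).open_baseSet.mem_nhds
    (mem_baseSet_trivializationAt F₂ V₂ x₀)] with y hy1 hy2
  rw [hom_trivializationAt_apply]
  change _ = (ContinuousLinearMap.inCoordinates F₁ V₁ F₂ V₂ x₀ y x₀ y (L y))
    ((trivializationAt F₁ V₁ x₀ ⟨y, s y⟩).2)
  rw [ContinuousLinearMap.inCoordinates_eq hy1 hy2]
  simp [hy1]

theorem trivializationAt_dual_apply {x₀ x : M} (hx : x ∈ (trivializationAt F₁ V₁ x₀).baseSet)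
    (u : Dual V₁ x) (w : F₁) :
    (trivializationAt (DualModel F₁) (Dual V₁) x₀ ⟨x, u⟩).2 w =
      u ((trivializationAt F₁ V₁ x₀).symm x w) := by
  rw [hom_trivializationAt_apply]
  simp [ContinuousLinearMap.inCoordinates, hx]

theorem contMDiffAt_dual_apply {u : ∀ x, Dual V₁ x} {s : ∀ x, V₁ x} {x₀ : M}
    (hu : ContMDiffAt (𝓡 n) 𝓘(ℝ, DualModel F₁) ∞
      (fun x => (trivializationAt (DualModel F₁) (Dual V₁) x₀ ⟨x, u x⟩).2) x₀)
    (hs : ContMDiffAt (𝓡 n) 𝓘(ℝ, F₁) ∞ (fun x => (trivializationAt F₁ V₁ x₀ ⟨x, s x⟩).2) x₀) :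
    ContMDiffAt (𝓡 n) 𝓘(ℝ, ℂ) ∞ (fun x => (u x (s x) : ℂ)) x₀ := by
  have hB : ContDiff ℝ ∞ (fun p : DualModel F₁ × F₁ => p.1 p.2) :=
    (contDiff_fst.clm_apply contDiff_snd : ContDiff ℂ ∞ _).restrict_scalars ℝ
  refine (hB.contDiffAt.comp_contMDiffAt (hu.prodMk_space hs)).congr_of_eventuallyEq ?_
  filter_upwards [(trivializationAt F₁ V₁ x₀).open_baseSet.mem_nhds
    (mem_baseSet_trivializationAt F₁ V₁ x₀)] with y hy
  change _ = (trivializationAt (DualModel F₁) (Dual V₁) x₀ ⟨y, u y⟩).2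
    (trivializationAt F₁ V₁ x₀ ⟨y, s y⟩).2
  rw [trivializationAt_dual_apply hy, Trivialization.symm_apply_apply_mk _ hy]

theorem goodDomain_dual (x₀ : M) :
    goodDomain n (DualModel F₁) (Dual V₁) x₀ = goodDomain n F₁ V₁ x₀ := by
  simp [goodDomain, hom_trivializationAt_baseSet]

theorem DerivBound.mono {x₀ : M} {L : Set M} {m m' : ℕ} {f : TestSec n F₁ V₁} {A : ℝ}
    (h : DerivBound n x₀ L m f A) (hm : m' ≤ m) : DerivBound n x₀ L m' f A :=
  fun j hj => h j (hj.trans hm)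

end Pointwise

/-! ## Local representatives -/

section LocalCoordinates

/-- The part of the coordinate domain over which the bundle is trivialized. -/
def coordDomain (n : ℕ) {M : Type*} [TopologicalSpace M] [ChartedSpace (Coord n) M]
    (F : Type*) [NormedAddCommGroup F] (E : M → Type*) [∀ x, TopologicalSpace (E x)]
    [TopologicalSpace (TotalSpace F E)] [FiberBundle F E] (x₀ : M) : Set (Coord n) :=
  (extChartAt (𝓡 n) x₀).target ∩
    (extChartAt (𝓡 n) x₀).symm ⁻¹' (trivializationAt F E x₀).baseSet

variable {F : Type*} [NormedAddCommGroup F]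
  {E : M → Type*} [∀ x, TopologicalSpace (E x)] [TopologicalSpace (TotalSpace F E)]
  [FiberBundle F E]

theorem isOpen_coordDomain (x₀ : M) : IsOpen (coordDomain n F E x₀) :=
  (continuousOn_extChartAt_symm x₀).isOpen_inter_preimage (isOpen_extChartAt_target x₀)
    (trivializationAt F E x₀).open_baseSet

theorem contDiffOn_comp_extChartAt_symm [IsManifold (𝓡 n) ∞ M] {G : Type*} [NormedAddCommGroup G] [NormedSpace ℝ G]
    {x₀ : M} {φ : M → G}
    (h : ∀ x ∈ (trivializationAt F E x₀).baseSet, ContMDiffAt (𝓡 n) 𝓘(ℝ, G) ∞ φ x) :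
    ContDiffOn ℝ ∞ (fun y => φ ((extChartAt (𝓡 n) x₀).symm y)) (coordDomain n F E x₀) := by
  rw [← contMDiffOn_iff_contDiffOn]
  intro y hy
  exact (h _ hy.2).comp_contMDiffWithinAt y
    ((contMDiffOn_extChartAt_symm x₀ y hy.1).mono inter_subset_left)

variable [NormedSpace ℂ F] [∀ x, AddCommGroup (E x)] [∀ x, Module ℂ (E x)] [VectorBundle ℂ F E]
  [VectorBundle ℝ F E] [ContMDiffVectorBundle ∞ F E (𝓡 n)]

theorem contDiffOn_localRep [IsManifold (𝓡 n) ∞ M] (x₀ : M) (f : TestSec n F E) :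
    ContDiffOn ℝ ∞ (localRep n x₀ f) (coordDomain n F E x₀) :=
  contDiffOn_comp_extChartAt_symm (E := E) fun x hx =>
    ((trivializationAt F E x₀).contMDiffAt_section_iff hx).1 (f.2.1 x)

/-- In the trivialization at `x₀` this section is constant, and smoothness at `x` does not depend on
the trivialization because the bundle is smooth. -/
theorem contMDiffAt_symmL_trivializationAt {x₀ x : M} (hx : x ∈ (trivializationAt F E x₀).baseSet)
    (v : F) : ContMDiffAt (𝓡 n) 𝓘(ℝ, F) ∞ (fun y => (trivializationAt F E x
      ⟨y, (trivializationAt F E x₀).symmL ℂ y v⟩).2) x := by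
  rw [← Bundle.contMDiffAt_section, (trivializationAt F E x₀).contMDiffAt_section_iff hx]
  refine (contMDiffAt_const (c := v)).congr_of_eventuallyEq ?_
  filter_upwards [(trivializationAt F E x₀).open_baseSet.mem_nhds hx] with y hy
  rw [Trivialization.symmL_apply _ hy, Trivialization.apply_mk_symm _ hy]

end LocalCoordinates

/-! ## The transpose in local coordinates -/

section Transpose

variable {F : Type*} [NormedAddCommGroup F] [NormedSpace ℂ F]
  {E : M → Type*} [∀ x, AddCommGroup (E x)] [∀ x, Module ℂ (E x)] [∀ x, TopologicalSpace (E x)]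
  [∀ x, IsTopologicalAddGroup (E x)] [∀ x, ContinuousSMul ℂ (E x)]
  [TopologicalSpace (TotalSpace F E)] [FiberBundle F E] [VectorBundle ℂ F E]
  {H : HermitianForm n F E} (K : Conjugation H)

/-- The bilinear form `(v, w) ↦ ⟨conj v, w⟩` on the model fibre, transported to it from the fibre
over `x` by the trivialization at `x₀`. -/
def Conjugation.localForm (x₀ x : M) : F →ₗ[ℂ] F →ₗ[ℂ] ℂ :=
  LinearMap.mk₂ ℂ (fun v w => (H.form x (K.conj x ((trivializationAt F E x₀).symmL ℂ x v))
      ((trivializationAt F E x₀).symmL ℂ x w) : ℂ))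
    (fun v v' w => by simp only [map_add, add_apply])
    (fun c v w => by
      rw [map_smul, (K.conj x).map_smulₛₗ, (H.form x).map_smulₛₗ, Complex.conj_conj]
      rfl)
    (fun v w w' => by rw [map_add, map_add])
    (fun c v w => by rw [map_smul, map_smul])

theorem Conjugation.trivializationAt_transpose (f : TestSec n F E) {x₀ x : M}
    (hx : x ∈ (trivializationAt F E x₀).baseSet) (w : F) :
    (trivializationAt (DualModel F) (Dual E) x₀ ⟨x, (K.transpose f).1 x⟩).2 w =
      K.localForm x₀ x (trivializationAt F E x₀ ⟨x, f.1 x⟩).2 w := by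
  rw [trivializationAt_dual_apply hx, Conjugation.localForm, LinearMap.mk₂_apply,
    Trivialization.symmL_apply _ hx, Trivialization.symmL_apply _ hx,
    Trivialization.symm_apply_apply_mk _ hx]
  rfl

variable [VectorBundle ℝ F E] [ContMDiffVectorBundle ∞ F E (𝓡 n)]

theorem Conjugation.contMDiffAt_localForm {x₀ x : M}
    (hx : x ∈ (trivializationAt F E x₀).baseSet) (v w : F) :
    ContMDiffAt (𝓡 n) 𝓘(ℝ, ℂ) ∞ (fun y => K.localForm x₀ y v w) x :=
  contMDiffAt_dual_apply (contMDiffAt_apply_conj H.smooth (contMDiffAt_apply_conj K.smooth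
    (contMDiffAt_symmL_trivializationAt hx v))) (contMDiffAt_symmL_trivializationAt hx w)

variable [IsManifold (𝓡 n) ∞ M] [FiniteDimensional ℂ F]

/-- In local coordinates the transpose is multiplication with a smooth matrix. -/
theorem Conjugation.exists_localRep_transpose (x₀ : M) :
    ∃ (N : ℕ) (τ : Fin N × Fin N → Coord n → ℂ) (Q : Fin N × Fin N → F →L[ℂ] DualModel F),
      (∀ p, ContDiffOn ℝ ∞ (τ p) (coordDomain n F E x₀)) ∧
      ∀ f : TestSec n F E, ∀ y ∈ coordDomain n F E x₀,
        localRep n x₀ (K.transpose f) y = ∑ p, τ p y • Q p (localRep n x₀ f y) := by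
  -- Expanding `localForm` in a basis separates the smooth matrix entries `τ` from the constant
  -- rank-one maps `Q`.
  let b := Module.finBasis ℂ F
  let c : Fin (Module.finrank ℂ F) → DualModel F := fun i => (b.coord i).toContinuousLinearMap
  refine ⟨_, fun p y => K.localForm x₀ ((extChartAt (𝓡 n) x₀).symm y) (b p.1) (b p.2),
    fun p => (c p.1).smulRight (c p.2), fun p => ?_, fun f y hy => ?_⟩
  · exact contDiffOn_comp_extChartAt_symm (E := E) fun x hx => K.contMDiffAt_localForm hx _ _
  · ext w
    refine (K.trivializationAt_transpose f hy.2 w).trans ?_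
    change K.localForm x₀ _ (localRep n x₀ f y) w = _
    rw [← LinearMap.sum_repr_mul_repr_mul b b, Fintype.sum_prod_type]
    simp only [Finsupp.sum_fintype, zero_smul, smul_zero, Finset.sum_const_zero, implies_true,
      sum_apply]
    refine Finset.sum_congr rfl fun i _ => Finset.sum_congr rfl fun j _ => ?_
    simp only [c, smul_apply, ContinuousLinearMap.smulRight_apply,
      LinearMap.coe_toContinuousLinearMap', Module.Basis.coord_apply, smul_eq_mul]
    ring

/-- The transpose is continuous in the sense of distributions. -/
theorem Conjugation.exists_derivBound_transpose (x₀ : M) {L : Set M} (hL : IsCompact L)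
    (hLd : L ⊆ goodDomain n F E x₀) (m : ℕ) :
    ∃ D : ℝ, 0 ≤ D ∧ ∀ (f : TestSec n F E) (A : ℝ), 0 ≤ A → DerivBound n x₀ L m f A →
      DerivBound n x₀ L m (K.transpose f) (D * A) := by
  obtain ⟨N, τ, Q, hτ, hTf⟩ := K.exists_localRep_transpose x₀
  set U := coordDomain n F E x₀
  have hU : IsOpen U := isOpen_coordDomain x₀
  have hLU : ∀ x ∈ L, extChartAt (𝓡 n) x₀ x ∈ U := by
    intro x hx
    have hxs : x ∈ (extChartAt (𝓡 n) x₀).source := by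
      rw [extChartAt_source]; exact (hLd hx).1
    refine ⟨(extChartAt (𝓡 n) x₀).map_source hxs, ?_⟩
    change (extChartAt (𝓡 n) x₀).symm _ ∈ (trivializationAt F E x₀).baseSet
    rw [(extChartAt (𝓡 n) x₀).left_inv hxs]
    exact (hLd hx).2
  have hLc : IsCompact (extChartAt (𝓡 n) x₀ '' L) :=
    hL.image_of_continuousOn ((continuousOn_extChartAt (I := 𝓡 n) x₀).mono fun x hx => by
      rw [extChartAt_source]; exact (hLd hx).1)
  obtain ⟨D, hD, hbd⟩ := exists_bound_iteratedFDeriv_sum_smul hU hτ Q hLc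
    (image_subset_iff.2 hLU) m
  refine ⟨D, hD, fun f A hA hf j hj x hx => ?_⟩
  -- The matrix formula holds only on the open set `U`; equality near the point suffices for
  -- derivatives there.
  have heq : localRep n x₀ (K.transpose f) =ᶠ[𝓝 (extChartAt (𝓡 n) x₀ x)]
      fun z => ∑ p, τ p z • Q p (localRep n x₀ f z) := by
    filter_upwards [hU.mem_nhds (hLU x hx)] with z hz using hTf f z hz
  rw [(heq.iteratedFDeriv ℝ j).eq_of_nhds]
  exact hbd _ A hA (contDiffOn_localRep x₀ f) _ (mem_image_of_mem _ hx)
    (fun i hi => hf i hi x hx) j hj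

end Transpose

end

section

variable {n : ℕ} {M : Type*} [TopologicalSpace M] [ChartedSpace (Coord n) M]
  [IsManifold (𝓡 n) ∞ M]
  {F : Type*} [NormedAddCommGroup F] [NormedSpace ℂ F]
  {E : M → Type*} [∀ x, AddCommGroup (E x)] [∀ x, Module ℂ (E x)] [∀ x, TopologicalSpace (E x)]
  [∀ x, IsTopologicalAddGroup (E x)] [∀ x, ContinuousSMul ℂ (E x)]
  [TopologicalSpace (TotalSpace F E)] [FiberBundle F E] [VectorBundle ℂ F E]
  {H : HermitianForm n F E} (K : Conjugation H)

/-! ## The two-point distribution of the hermitian field -/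

/-- The conjugation and the first slot of the hermitian form each conjugate the phase, so it comes
out unchanged. This keeps the sign of the frequency, and thus the covector. -/
theorem Conjugation.transpose_oscillate (x₀ : M) (k : Coord n →L[ℝ] ℝ) (f : TestSec n F E)
    (hf : secSupport f.1 ⊆ (chartAt (Coord n) x₀).source) :
    K.transpose (oscillate x₀ k f hf) = oscillate x₀ k (K.transpose f)
      ((K.secSupport_transpose_subset f).trans hf) :=
  Subtype.ext (funext fun x => by
    change H.form x (K.conj x (_ • f.1 x)) = _ • H.form x (K.conj x (f.1 x))
    rw [(K.conj x).map_smulₛₗ, (H.form x).map_smulₛₗ, Complex.conj_conj])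

section

variable [VectorBundle ℝ F E] [ContMDiffVectorBundle ∞ F E (𝓡 n)] [FiniteDimensional ℂ F]

/-- The distribution `f ⊗ h ↦ (W₁(f^T ⊗ h) + W₂(f ⊗ h^T)) / 2`. -/
def Conjugation.average (W₁ : Bidistribution n (DualModel F) (Dual E) F E)
    (W₂ : Bidistribution n F E (DualModel F) (Dual E)) : Bidistribution n F E F E where
  toFun := (1 / 2 : ℂ) • (W₁.toFun ∘ₗ K.transposeLin + W₂.toFun.compl₂ K.transposeLin)
  continuous := by
    intro x₁ x₂ L₁ L₂ hL₁ hL₂ hd₁ hd₂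
    obtain ⟨m₁, C₁, hC₁⟩ := W₁.continuous x₁ x₂ L₁ L₂ hL₁ hL₂
      (hd₁.trans (goodDomain_dual x₁).ge) hd₂
    obtain ⟨m₂, C₂, hC₂⟩ := W₂.continuous x₁ x₂ L₁ L₂ hL₁ hL₂ hd₁
      (hd₂.trans (goodDomain_dual x₂).ge)
    obtain ⟨D₁, hD₁, hb₁⟩ := K.exists_derivBound_transpose x₁ hL₁ hd₁ m₁
    obtain ⟨D₂, hD₂, hb₂⟩ := K.exists_derivBound_transpose x₂ hL₂ hd₂ m₂
    refine ⟨max m₁ m₂, 1 / 2 * (C₁ * D₁ + C₂ * D₂), fun f h hf hh A₁ A₂ hA₁ hA₂ hfA hhA => ?_⟩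
    have e₁ := hC₁ (K.transpose f) h ((K.secSupport_transpose_subset f).trans hf) hh (D₁ * A₁) A₂
      (by positivity) hA₂ (hb₁ f A₁ hA₁ (hfA.mono (le_max_left _ _))) (hhA.mono (le_max_left _ _))
    have e₂ := hC₂ f (K.transpose h) hf ((K.secSupport_transpose_subset h).trans hh) A₁ (D₂ * A₂)
      hA₁ (by positivity) (hfA.mono (le_max_right _ _))
      (hb₂ h A₂ hA₂ (hhA.mono (le_max_right _ _)))
    change ‖(1 / 2 : ℂ) * (W₁ (K.transpose f) h + W₂ f (K.transpose h))‖ ≤ _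
    have e₃ := norm_add_le (W₁ (K.transpose f) h) (W₂ f (K.transpose h))
    rw [norm_mul, show ‖(1 / 2 : ℂ)‖ = 1 / 2 by norm_num]
    linarith

theorem Conjugation.average_apply (W₁ : Bidistribution n (DualModel F) (Dual E) F E)
    (W₂ : Bidistribution n F E (DualModel F) (Dual E)) (f h : TestSec n F E) :
    K.average W₁ W₂ f h = (1 / 2 : ℂ) * (W₁ (K.transpose f) h + W₂ f (K.transpose h)) := rfl

/-- Transposition neither enlarges supports nor alters phases, so on the intersected neighbourhoods
both terms inherit the rapid decay of `W₁` and `W₂`. -/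
theorem MicrolocallySmoothAt.average {W₁ : Bidistribution n (DualModel F) (Dual E) F E}
    {W₂ : Bidistribution n F E (DualModel F) (Dual E)} {p q : Cotangent n M}
    (h₁ : MicrolocallySmoothAt W₁ p q) (h₂ : MicrolocallySmoothAt W₂ p q) :
    MicrolocallySmoothAt (K.average W₁ W₂) p q := by
  obtain ⟨U₁, hU₁, U₁', hU₁', N₁, hN₁, hs₁, hs₁', h₁⟩ := h₁
  obtain ⟨U₂, hU₂, U₂', hU₂', N₂, hN₂, hs₂, hs₂', h₂⟩ := h₂
  refine ⟨U₁ ∩ U₂, inter_mem hU₁ hU₂, U₁' ∩ U₂', inter_mem hU₁' hU₂', N₁ ∩ N₂,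
    inter_mem hN₁ hN₂, inter_subset_left.trans hs₁, inter_subset_left.trans hs₁',
    fun f h hf hh m => ?_⟩
  obtain ⟨C₁, hC₁⟩ := h₁ (K.transpose f) h
    ((K.secSupport_transpose_subset f).trans (hf.trans inter_subset_left))
    (hh.trans inter_subset_left) m
  obtain ⟨C₂, hC₂⟩ := h₂ f (K.transpose h) (hf.trans inter_subset_right)
    ((K.secSupport_transpose_subset h).trans (hh.trans inter_subset_right)) m
  refine ⟨1 / 2 * (C₁ + C₂), fun t ht k hk => ?_⟩
  rw [K.average_apply, K.transpose_oscillate, K.transpose_oscillate, norm_mul,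
    show ‖(1 / 2 : ℂ)‖ = 1 / 2 by norm_num, mul_div_assoc, add_div]
  gcongr
  exact (norm_add_le _ _).trans (add_le_add (hC₁ t ht k hk.1) (hC₂ t ht k hk.2))

theorem Conjugation.WFPrime_average_subset (W₁ : Bidistribution n (DualModel F) (Dual E) F E)
    (W₂ : Bidistribution n F E (DualModel F) (Dual E)) :
    WFPrime (K.average W₁ W₂) ⊆ WFPrime W₁ ∪ WFPrime W₂ := by
  rintro pq ⟨h0, h⟩
  by_contra hc
  rw [mem_union, not_or] at hc
  refine h (MicrolocallySmoothAt.average K ?_ ?_)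
  · by_contra h'
    exact hc.1 ⟨h0, h'⟩
  · by_contra h'
    exact hc.2 ⟨h0, h'⟩

end

end

end QFT

end

/-! ### Assembly -/

theorem mainTheorem11
    (n : ℕ) (hn : 2 ≤ n)
    {M : Type*} [TopologicalSpace M] [ChartedSpace (EuclideanSpace ℝ (Fin n)) M]
    [IsManifold (𝓡 n) ∞ M] [T2Space M] [SigmaCompactSpace M] [MeasurableSpace M] [BorelSpace M]
    (S : Spacetime n M) (hS : S.IsGloballyHyperbolic)
    {F : Type*} [NormedAddCommGroup F] [NormedSpace ℂ F] [FiniteDimensional ℂ F]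
    {E : M → Type*} [∀ x, AddCommGroup (E x)] [∀ x, Module ℂ (E x)] [∀ x, TopologicalSpace (E x)]
    [∀ x, IsTopologicalAddGroup (E x)] [∀ x, ContinuousSMul ℂ (E x)]
    [TopologicalSpace (TotalSpace F E)] [FiberBundle F E] [VectorBundle ℂ F E]
    [VectorBundle ℝ F E] [ContMDiffVectorBundle ∞ F E (𝓡 n)]
    (H : HermitianForm n F E) (B : NormallyHyperbolic F E S) (hB : IsFormallySelfAdjoint H B)
    (K : Conjugation H) (hK : CommutesWithConj B K)
    (st : ComplexAlg H B →ₗ[ℂ] ℂ)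
    (W₁ : Bidistribution n (DualModel F) (Dual E) F E)
    (W₂ : Bidistribution n F E (DualModel F) (Dual E))
    (hst : IsGaugeInvariantQuasifree st W₁ W₂) (hW : IsHadamardComplex S W₁ W₂) :
    ∃ W : Bidistribution n F E F E,
      (∀ f h, W f h = (1 / 2 : ℂ) *
        (W₂ f (K.transpose h) + W₂ h (K.transpose f) + Complex.I * pauliJordan B K f h)) ∧
      IsHadamardHermitian S W ∧
      ∃! st' : HermitianAlg B K →ₗ[ℂ] ℂ, IsQuasifree st' W := by
  -- The symmetric form of the average serves continuity, wavefront set and pullback; the commutator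
  -- converts it to the stated formula.
  have hf : ∀ f h, K.average W₁ W₂ f h = (1 / 2 : ℂ) *
      (W₂ f (K.transpose h) + W₂ h (K.transpose f) + Complex.I * pauliJordan B K f h) := by
    intro f h
    rw [K.average_apply, hst.transpose_commutator K f h]
    ring
  refine ⟨K.average W₁ W₂, hf, ?_, ?_⟩
  · refine (K.WFPrime_average_subset W₁ W₂).trans ?_
    rw [hW.1, hW.2, union_self]
  · obtain ⟨st', hst'⟩ := hst.exists_isQuasifree hB hK _ (K.average_apply W₁ W₂)
    exact ⟨st', hst', fun _ h => h.unique hst'⟩
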